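/- Let $W$ be a finite group acting faithfully and irreducibly on a complex vector space $V$ of dimension $n$ and generated by elements acting as complex reflections. Let $S=\mathbb{C}[V]=\mathrm{Sym}(V^*)$, graded with $V^*$ in degree $1$, and let $A=S/(S\cdot S^W_+)$ be the algebra of coinvariants. Let $H\subseteq S$ be the space of harmonic polynomials, i.e. those killed by all $W$-invariant constant-coefficient differential operators without constant term. Grade $\mathrm{Hom}_W(V,-)$ and $\mathrm{Hom}_W(V^*,-)$ by placing $V$ in degree $-1$ and $V^*$ in degree $1$: thus $\mathrm{Hom}_W(V,A)_k$ consists of the equivariant maps $V\to A_{k-1}$ and $\mathrm{Hom}_W(V^*,A)_k$ of the equivariant maps $V^*\to A_{k+1}$, and similarly for $H$. The degrees $d_1\le\dots\le d_n=:d$ of $W$ are the degrees in which $\mathrm{Hom}_W(V,H)$ is nonzero, and the codegrees $d_1^*\ge\dots\ge d_n^*$ those in which $\mathrm{Hom}_W(V^*,H)$ is nonzero, both counted with multiplicity. Suppose that $W$ is a duality group, that is, $d_i+d_i^*=d$ for all $i$. Then $\mathrm{Hom}_W(V,A)_d$ is one-dimensional. Moreover, the canonical map $H\hookrightarrow S\twoheadrightarrow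 A$ is bijective; the canonical algebra map $\mathrm{Sym}_{\mathbb{C}}(\mathrm{Hom}_W(V,H))\to S^W$, induced by $\mathrm{Hom}_W(V,H)\cong(V^*\otimes H)^W\to S^W$ (multiplication in $S$), is an isomorphism; and the pairing $$\mathrm{Hom}_W(V,A)\otimes\mathrm{Hom}_W(V^*,A)\to\mathrm{Hom}_W(V,A)_d$$ defined below is perfect, i.e. it induces isomorphisms $\mathrm{Hom}_W(V,A)\cong\mathrm{Hom}_{\mathbb{C}}(\mathrm{Hom}_W(V^*,A),\mathrm{Hom}_W(V,A)_d)$ and $\mathrm{Hom}_W(V^*,A)\cong\mathrm{Hom}_{\mathbb{C}}(\mathrm{Hom}_W(V,A),\mathrm{Hom}_W(V,A)_d)$. The pairing is obtained as follows. Lift along $H\cong A$ to $\varphi\in\mathrm{Hom}_W(V,H)$ and $\psi\in\mathrm{Hom}_W(V^*,H)$. Form $\sum_i\varphi(b_i)\psi(b_i^*)\in S^W$ for a basis $(b_i)$ of $V$ with dual basis $(b_i^*)$. Then apply the projection $$S^W\cong\mathrm{Sym}_{\mathbb{C}}(\mathrm{Hom}_W(V,H))\twoheadrightarrow\mathrm{Hom}_W(V,H)\twoheadrightarrow\mathrm{Hom}_W(V,H)_d\cong\mathrm{Hom}_W(V,A)_d.$$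 This pairing is concentrated in degree $d$ and so realises the duality $d_i+d_i^*=d$: it vanishes on $\mathrm{Hom}_W(V,A)_i\otimes\mathrm{Hom}_W(V^*,A)_j$ whenever $i+j\ne d$, and for every integer $k$ it restricts to a perfect pairing $\mathrm{Hom}_W(V,A)_k\otimes\mathrm{Hom}_W(V^*,A)_{d-k}\to\mathrm{Hom}_W(V,A)_d$. -/

import Mathlib

noncomputable section

namespace ReflectionGroup

/-- A complex reflection: a linear endomorphism `g` whose fixed space is a hyperplane, that is,
`g - 1` has rank one. (For an element of a finite linear group, finite order is automatic.) -/
def IsReflection {V : Type*} [AddCommGroup V] [Module ℂ V] (g : V →ₗ[ℂ] V) : Prop :=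
  Module.finrank ℂ (LinearMap.range (g - LinearMap.id)) = 1

/-- The finite group `W`, acting on `V` through `ρ`, is an irreducible complex reflection group:
the action is faithful and irreducible, and `W` is generated by the elements acting as
reflections. -/
structure IsIrreducibleReflectionGroup {V W : Type*} [AddCommGroup V] [Module ℂ V]
    [Group W] (ρ : Representation ℂ W V) : Prop where
  finite : Finite W
  faithful : Function.Injective ρ
  generated : Subgroup.closure {w : W | IsReflection (ρ w)} = ⊤
  irreducible : ρ.IsIrreducible

section Polynomials

variable {n : ℕ} {V W : Type*} [AddCommGroup V] [Module ℂ V] [Group W]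
  (b : Module.Basis (Fin n) ℂ V) (ρ : Representation ℂ W V)

/-- The inclusion `V* → ℂ[V]`. The algebra `ℂ[V] = Sym(V*)` is the polynomial algebra whose
variable `X i` is the `i`-th coordinate function of the basis `b` of `V`. -/
def linearForm : Module.Dual ℂ V →ₗ[ℂ] MvPolynomial (Fin n) ℂ where
  toFun ξ := ∑ i, ξ (b i) • MvPolynomial.X i
  map_add' ξ η := by simp [add_smul, Finset.sum_add_distrib]
  map_smul' c ξ := by simp [mul_smul, Finset.smul_sum]

lemma linearForm_coord (i : Fin n) : linearForm b (b.coord i) = MvPolynomial.X i := by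
  simp [linearForm, Finsupp.single_apply, ite_smul]

/-- The action of `w ∈ W` on `ℂ[V]`, by the algebra map extending the action on `V*`. -/
def polyAct (w : W) : MvPolynomial (Fin n) ℂ →ₐ[ℂ] MvPolynomial (Fin n) ℂ :=
  MvPolynomial.aeval fun i => linearForm b (ρ.dual w (b.coord i))

lemma polyAct_linearForm (w : W) (ξ : Module.Dual ℂ V) :
    polyAct b ρ w (linearForm b ξ) = linearForm b (ρ.dual w ξ) := by
  have h : ξ = ∑ i, ξ (b i) • b.coord i := by
    refine b.ext fun j => ?_
    simp
  conv_rhs => rw [h]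
  simp only [map_sum, map_smul]
  conv_lhs => rw [show linearForm b ξ = ∑ i, ξ (b i) • MvPolynomial.X i from rfl]
  simp only [map_sum, map_smul, polyAct, MvPolynomial.aeval_X]

/-- The algebra of invariants `ℂ[V]^W`. -/
def invariants : Subalgebra ℂ (MvPolynomial (Fin n) ℂ) where
  carrier := {f | ∀ w, polyAct b ρ w f = f}
  mul_mem' hf hg w := by rw [map_mul, hf w, hg w]
  add_mem' hf hg w := by rw [map_add, hf w, hg w]
  algebraMap_mem' c w := AlgHom.commutes _ c

/-- The Hilbert ideal of `ℂ[V]`, generated by the invariants without constant term. -/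
def hilbertIdeal : Ideal (MvPolynomial (Fin n) ℂ) :=
  Ideal.span {f | f ∈ invariants b ρ ∧ MvPolynomial.constantCoeff f = 0}

/-- The algebra of coinvariants `A = ℂ[V] / (ℂ[V]^W_+)`. -/
abbrev Coinvariants : Type := MvPolynomial (Fin n) ℂ ⧸ hilbertIdeal b ρ

lemma hilbertIdeal_le_comap (w : W) :
    hilbertIdeal b ρ ≤ (hilbertIdeal b ρ).comap (polyAct b ρ w) := by
  refine Ideal.span_le.2 fun f hf => ?_
  change polyAct b ρ w f ∈ hilbertIdeal b ρ
  rw [hf.1 w]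
  exact Ideal.subset_span hf

/-- The action of `w ∈ W` on the algebra of coinvariants. -/
def coinvAct (w : W) : Coinvariants b ρ →ₐ[ℂ] Coinvariants b ρ :=
  Ideal.quotientMapₐ (hilbertIdeal b ρ) (polyAct b ρ w) (hilbertIdeal_le_comap b ρ w)

/-- The quotient map `ℂ[V] → A`, as a linear map. -/
def toCoinvariants : MvPolynomial (Fin n) ℂ →ₗ[ℂ] Coinvariants b ρ :=
  (Ideal.Quotient.mkₐ ℂ (hilbertIdeal b ρ)).toLinearMap

lemma coinvAct_toCoinvariants (w : W) (f : MvPolynomial (Fin n) ℂ) :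
    coinvAct b ρ w (toCoinvariants b ρ f) = toCoinvariants b ρ (polyAct b ρ w f) := rfl

/-- The derivation `∂_v` of `ℂ[V]` attached to a vector `v`, with `∂_v ξ = ξ v` for `ξ ∈ V*`. -/
def dirDeriv (v : V) : Derivation ℂ (MvPolynomial (Fin n) ℂ) (MvPolynomial (Fin n) ℂ) :=
  MvPolynomial.mkDerivation ℂ fun i => MvPolynomial.C (b.coord i v)

/-- The algebra of differential operators on `ℂ[V]` with constant coefficients, the algebra of
endomorphisms generated by the `∂_v`; it is the image of `Sym(V)`. -/
def constCoeffOps : Subalgebra ℂ (Module.End ℂ (MvPolynomial (Fin n) ℂ)) :=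
  Algebra.adjoin ℂ (Set.range fun v : V => (dirDeriv b v).toLinearMap)

/-- The space `H` of harmonic polynomials: those killed by every `W`-invariant differential
operator with constant coefficients and without constant term. Invariance under the action of
`W` by conjugation means commuting with `W`, and `D 1` is the constant term of `D`. -/
def harmonics : Submodule ℂ (MvPolynomial (Fin n) ℂ) where
  carrier := {q | ∀ D ∈ constCoeffOps b,
    (∀ w f, D (polyAct b ρ w f) = polyAct b ρ w (D f)) → D 1 = 0 → D q = 0}
  add_mem' hf hg D hD hW h1 := by rw [map_add, hf D hD hW h1, hg D hD hW h1, add_zero]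
  zero_mem' D _ _ _ := map_zero D
  smul_mem' c f hf D hD hW h1 := by rw [map_smul, hf D hD hW h1, smul_zero]

lemma polyAct_mem_harmonics (w : W) {q : MvPolynomial (Fin n) ℂ} (hq : q ∈ harmonics b ρ) :
    polyAct b ρ w q ∈ harmonics b ρ := by
  intro D hD hW h1
  rw [hW, hq D hD hW h1, map_zero]

/-- The canonical map `H ↪ ℂ[V] ↠ A`. -/
def harmonicsToCoinvariants : harmonics b ρ →ₗ[ℂ] Coinvariants b ρ :=
  toCoinvariants b ρ ∘ₗ (harmonics b ρ).subtype

/-- The polynomials in `ℂ[V]` homogeneous of degree `j : ℤ` (only `0` if `j < 0`). -/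
def polyDeg (n : ℕ) : ℤ → Submodule ℂ (MvPolynomial (Fin n) ℂ)
  | Int.ofNat m => MvPolynomial.homogeneousSubmodule (Fin n) ℂ m
  | Int.negSucc _ => ⊥

/-- The projection of `ℂ[V]` onto its homogeneous component of degree `j : ℤ`. -/
def polyComponent (n : ℕ) : ℤ → (MvPolynomial (Fin n) ℂ →ₗ[ℂ] MvPolynomial (Fin n) ℂ)
  | Int.ofNat m => MvPolynomial.homogeneousComponent m
  | Int.negSucc _ => 0

/-- The homogeneous component `A_j`, `j : ℤ`, of the algebra of coinvariants. -/
def coinvDeg (j : ℤ) : Submodule ℂ (Coinvariants b ρ) :=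
  (polyDeg n j).map (toCoinvariants b ρ)

lemma polyComponent_mem (j : ℤ) (f : MvPolynomial (Fin n) ℂ) :
    polyComponent n j f ∈ polyDeg n j := by
  cases j with
  | ofNat m => exact MvPolynomial.homogeneousComponent_mem m f
  | negSucc m => exact Submodule.zero_mem _

lemma polyAct_isHomogeneous (w : W) {f : MvPolynomial (Fin n) ℂ} {m : ℕ}
    (hf : f.IsHomogeneous m) : (polyAct b ρ w f).IsHomogeneous m := by
  have h := hf.aeval (fun i => linearForm b (ρ.dual w (b.coord i))) (n := 1) fun i => by
    refine MvPolynomial.IsHomogeneous.sum _ _ _ fun j _ => ?_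
    rw [MvPolynomial.smul_eq_C_mul]
    simpa using (MvPolynomial.isHomogeneous_C (Fin n) _).mul (MvPolynomial.isHomogeneous_X ℂ j)
  rwa [one_mul] at h

lemma polyComponent_polyAct (j : ℤ) (w : W) (f : MvPolynomial (Fin n) ℂ) :
    polyComponent n j (polyAct b ρ w f) = polyAct b ρ w (polyComponent n j f) := by
  cases j with
  | negSucc m => simp [polyComponent]
  | ofNat m =>
    change MvPolynomial.homogeneousComponent m (polyAct b ρ w f) =
      polyAct b ρ w (MvPolynomial.homogeneousComponent m f)
    conv_lhs => rw [← MvPolynomial.sum_homogeneousComponent f]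
    simp only [map_sum]
    have key : ∀ i, MvPolynomial.homogeneousComponent m
        (polyAct b ρ w (MvPolynomial.homogeneousComponent i f)) =
        if i = m then polyAct b ρ w (MvPolynomial.homogeneousComponent m f) else 0 := by
      intro i
      have hi := polyAct_isHomogeneous b ρ w (MvPolynomial.homogeneousComponent_isHomogeneous i f)
      rw [MvPolynomial.homogeneousComponent_of_mem hi]
      by_cases h : i = m
      · subst h; simp
      · simp [h, Ne.symm h]
    simp only [key, Finset.sum_ite_eq', Finset.mem_range]
    split_ifs with h
    · rfl
    · rw [MvPolynomial.homogeneousComponent_eq_zero _ _ (by omega), map_zero]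

end Polynomials

section Hom

variable {n : ℕ} {V W M : Type*} [AddCommGroup V] [Module ℂ V] [Group W]
  [AddCommGroup M] [Module ℂ M]
  (b : Module.Basis (Fin n) ℂ V) (ρ : Representation ℂ W V) (σ : Representation ℂ W M)

/-- `Hom_W(M, ℂ[V])`. -/
def homPoly : Submodule ℂ (M →ₗ[ℂ] MvPolynomial (Fin n) ℂ) where
  carrier := {φ | ∀ w m, φ (σ w m) = polyAct b ρ w (φ m)}
  add_mem' hφ hψ w m := by simp [hφ w m, hψ w m]
  zero_mem' _ _ := by simp
  smul_mem' c φ hφ w m := by simp [hφ w m]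

/-- `Hom_W(M, H)`. -/
def homHarm : Submodule ℂ (M →ₗ[ℂ] MvPolynomial (Fin n) ℂ) where
  carrier := {φ | φ ∈ homPoly b ρ σ ∧ ∀ m, φ m ∈ harmonics b ρ}
  add_mem' hφ hψ := ⟨add_mem hφ.1 hψ.1, fun m => add_mem (hφ.2 m) (hψ.2 m)⟩
  zero_mem' := ⟨zero_mem _, fun m => zero_mem (harmonics b ρ)⟩
  smul_mem' c _ hφ :=
    ⟨Submodule.smul_mem _ c hφ.1, fun m => Submodule.smul_mem (harmonics b ρ) c (hφ.2 m)⟩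

/-- The elements of `Hom_W(M, H)` with values in polynomials of degree `j`. -/
def homHarmTo (j : ℤ) : Submodule ℂ (M →ₗ[ℂ] MvPolynomial (Fin n) ℂ) where
  carrier := {φ | φ ∈ homHarm b ρ σ ∧ ∀ m, φ m ∈ polyDeg n j}
  add_mem' hφ hψ := ⟨add_mem hφ.1 hψ.1, fun m => add_mem (hφ.2 m) (hψ.2 m)⟩
  zero_mem' := ⟨zero_mem _, fun m => zero_mem (polyDeg n j)⟩
  smul_mem' c _ hφ :=
    ⟨Submodule.smul_mem _ c hφ.1, fun m => Submodule.smul_mem (polyDeg n j) c (hφ.2 m)⟩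

/-- `Hom_W(M, A)`. -/
def homCoinv : Submodule ℂ (M →ₗ[ℂ] Coinvariants b ρ) where
  carrier := {φ | ∀ w m, φ (σ w m) = coinvAct b ρ w (φ m)}
  add_mem' hφ hψ w m := by simp [hφ w m, hψ w m]
  zero_mem' _ _ := by simp
  smul_mem' c φ hφ w m := by simp [hφ w m]

/-- The elements of `Hom_W(M, A)` with values in `A_j`. -/
def homCoinvTo (j : ℤ) : Submodule ℂ (homCoinv b ρ σ) where
  carrier := {φ | ∀ m, φ.1 m ∈ coinvDeg b ρ j}
  add_mem' hφ hψ m := add_mem (hφ m) (hψ m)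
  zero_mem' _ := zero_mem (coinvDeg b ρ j)
  smul_mem' c _ hφ m := Submodule.smul_mem (coinvDeg b ρ j) c (hφ m)

/-- The graded piece `Hom_W(V, A)_k`. As `V` sits in degree `-1`, these are the maps with values
in `A_{k-1}`. -/
def homCoinvDeg (k : ℤ) : Submodule ℂ (homCoinv b ρ ρ) := homCoinvTo b ρ ρ (k - 1)

/-- The graded piece `Hom_W(V*, A)_k`. As `V*` sits in degree `1`, these are the maps with values
in `A_{k+1}`. -/
def homCoinvDualDeg (k : ℤ) : Submodule ℂ (homCoinv b ρ ρ.dual) := homCoinvTo b ρ ρ.dual (k + 1)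

/-- `a` lists the degrees of `W`, in increasing order: `k` occurs `dim Hom_W(V, H)_k` times. -/
def IsDegrees (a : Fin n → ℤ) : Prop :=
  Monotone a ∧ ∀ k, Nat.card {i // a i = k} = Module.finrank ℂ (homHarmTo b ρ ρ (k - 1))

/-- `c` lists the codegrees of `W`, in decreasing order: `k` occurs `dim Hom_W(V*, H)_k` times. -/
def IsCodegrees (c : Fin n → ℤ) : Prop :=
  Antitone c ∧ ∀ k, Nat.card {i // c i = k} = Module.finrank ℂ (homHarmTo b ρ ρ.dual (k + 1))

/-- `W` is a duality group with highest degree `d`: the degrees `a₁ ≤ ⋯ ≤ aₙ = d` and the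
codegrees `c₁ ≥ ⋯ ≥ cₙ` satisfy `aᵢ + cᵢ = d` for all `i`. -/
def IsDualityGroup (d : ℤ) : Prop :=
  ∃ a c : Fin n → ℤ, IsDegrees b ρ a ∧ IsCodegrees b ρ c ∧ IsGreatest (Set.range a) d ∧
    ∀ i, a i + c i = d

/-- If the canonical map `H → A` is bijective: the resulting map `Hom_W(M, A) → Hom_W(M, H)`,
composition with its inverse. -/
def liftHarm (hA : Function.Bijective (harmonicsToCoinvariants b ρ)) :
    homCoinv b ρ σ →ₗ[ℂ] homHarm b ρ σ :=
  LinearMap.codRestrict (homHarm b ρ σ)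
    ((LinearMap.compRight ℂ ((harmonics b ρ).subtype ∘ₗ
      (LinearEquiv.ofBijective (harmonicsToCoinvariants b ρ) hA).symm.toLinearMap)) ∘ₗ
      (homCoinv b ρ σ).subtype) (by
    intro φ
    set e := LinearEquiv.ofBijective (harmonicsToCoinvariants b ρ) hA with he
    refine ⟨fun w m => ?_, fun m => (e.symm (φ.1 m)).2⟩
    change ((e.symm (φ.1 (σ w m)) : harmonics b ρ) : MvPolynomial (Fin n) ℂ) =
      polyAct b ρ w (e.symm (φ.1 m) : harmonics b ρ)
    have h : e.symm (φ.1 (σ w m)) = ⟨polyAct b ρ w (e.symm (φ.1 m) : harmonics b ρ),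
        polyAct_mem_harmonics b ρ w (e.symm (φ.1 m)).2⟩ := by
      rw [LinearEquiv.symm_apply_eq, φ.2 w m]
      conv_lhs => rw [← e.apply_symm_apply (φ.1 m)]
      rfl
    rw [h])

end Hom

section Pairing

variable {n : ℕ} {V W : Type*} [AddCommGroup V] [Module ℂ V] [Group W]
  (b : Module.Basis (Fin n) ℂ V) (ρ : Representation ℂ W V)

/-- Multiply `φ : V → ℂ[V]` and `ψ : V* → ℂ[V]` and contract with the canonical element
`∑ bᵢ ⊗ bᵢ*` of `V ⊗ V*`. -/
def contract (φ : V →ₗ[ℂ] MvPolynomial (Fin n) ℂ)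
    (ψ : Module.Dual ℂ V →ₗ[ℂ] MvPolynomial (Fin n) ℂ) : MvPolynomial (Fin n) ℂ :=
  ∑ i, φ (b i) * ψ (b.coord i)

lemma contract_mem_invariants {φ : V →ₗ[ℂ] MvPolynomial (Fin n) ℂ}
    {ψ : Module.Dual ℂ V →ₗ[ℂ] MvPolynomial (Fin n) ℂ} (hφ : φ ∈ homPoly b ρ ρ)
    (hψ : ψ ∈ homPoly b ρ ρ.dual) : contract b φ ψ ∈ invariants b ρ := by
  intro w
  have hdual : ∀ i, ρ.dual w (b.coord i) = ∑ j, b.coord i (ρ w⁻¹ (b j)) • b.coord j := by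
    intro i
    refine b.ext fun k => ?_
    simp [Representation.dual_apply, Finsupp.single_apply, Module.Dual.transpose_apply]
  have hvec : ∀ j, ∑ i, b.coord i (ρ w⁻¹ (b j)) • ρ w (b i) = b j := by
    intro j
    have h := b.sum_repr (ρ w⁻¹ (b j))
    have h2 := congrArg (ρ w) h
    rwa [map_sum, ρ.self_inv_apply, Finset.sum_congr rfl fun i _ => map_smul (ρ w) _ _] at h2
  unfold contract
  rw [map_sum]
  calc ∑ i, polyAct b ρ w (φ (b i) * ψ (b.coord i))
      = ∑ i, φ (ρ w (b i)) * ψ (ρ.dual w (b.coord i)) := by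
        refine Finset.sum_congr rfl fun i _ => ?_
        rw [map_mul, hφ w, hψ w]
    _ = ∑ i, ∑ j, φ (b.coord i (ρ w⁻¹ (b j)) • ρ w (b i)) * ψ (b.coord j) := by
        refine Finset.sum_congr rfl fun i _ => ?_
        rw [hdual, map_sum, Finset.mul_sum]
        refine Finset.sum_congr rfl fun j _ => ?_
        rw [map_smul, map_smul, mul_smul_comm, smul_mul_assoc]
    _ = ∑ j, φ (b j) * ψ (b.coord j) := by
        rw [Finset.sum_comm]
        refine Finset.sum_congr rfl fun j _ => ?_
        rw [← Finset.sum_mul, ← map_sum, hvec]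

/-- The pairing `Hom_W(V, H) ⊗ Hom_W(V*, H) → ℂ[V]^W`. -/
def invariantPairing :
    homHarm b ρ ρ →ₗ[ℂ] homHarm b ρ ρ.dual →ₗ[ℂ] invariants b ρ :=
  LinearMap.mk₂ ℂ
    (fun φ ψ => ⟨contract b φ.1 ψ.1, contract_mem_invariants b ρ φ.2.1 ψ.2.1⟩)
    (fun φ φ' ψ => Subtype.ext (by simp [contract, add_mul, Finset.sum_add_distrib]))
    (fun c φ ψ => Subtype.ext (by simp [contract, Finset.smul_sum]))
    (fun φ ψ ψ' => Subtype.ext (by simp [contract, mul_add, Finset.sum_add_distrib]))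
    (fun c φ ψ => Subtype.ext (by simp [contract, Finset.smul_sum]))

lemma linearForm_mem : linearForm b ∈ homPoly b ρ ρ.dual :=
  fun w ξ => (polyAct_linearForm b ρ w ξ).symm

/-- The canonical map `Hom_W(V, H) ≅ (V* ⊗ H)^W → ℂ[V]^W`, multiplying elements of `V*` and
`H`. -/
def basicInvariant : homHarm b ρ ρ →ₗ[ℂ] invariants b ρ where
  toFun φ := ⟨contract b φ.1 (linearForm b),
    contract_mem_invariants b ρ φ.2.1 (linearForm_mem b ρ)⟩
  map_add' φ ψ := Subtype.ext (by simp [contract, add_mul, Finset.sum_add_distrib])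
  map_smul' c φ := Subtype.ext (by simp [contract, Finset.smul_sum])

/-- The canonical algebra map `Sym(Hom_W(V, H)) → ℂ[V]^W`. -/
def chevalleyMap : SymmetricAlgebra ℂ (homHarm b ρ ρ) →ₐ[ℂ] invariants b ρ :=
  SymmetricAlgebra.lift (basicInvariant b ρ)

/-- The projection `Sym(M) → Sym¹(M) = M`. It is induced by the algebra map
`Sym(M) → Sym(M) / Sym^{≥ 2}(M) = ℂ ⊕ M`. -/
def symLinearPart (M : Type*) [AddCommGroup M] [Module ℂ M] : SymmetricAlgebra ℂ M →ₗ[ℂ] M :=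
  letI : Module ℂᵐᵒᵖ M := Module.compHom M ((RingHom.id ℂ).fromOpposite mul_comm)
  haveI : IsCentralScalar ℂ M := ⟨fun _ _ => rfl⟩
  (TrivSqZeroExt.sndHom ℂ M) ∘ₗ
    (SymmetricAlgebra.lift (TrivSqZeroExt.inrHom ℂ M)).toLinearMap

lemma symLinearPart_ι (M : Type*) [AddCommGroup M] [Module ℂ M] (m : M) :
    symLinearPart M (SymmetricAlgebra.ι ℂ M m) = m := by
  simp [symLinearPart]

/-- The canonical map `Hom_W(V, H) ↠ Hom_W(V, H)_d → Hom_W(V, A)_d`: take the component of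
degree `d` and reduce modulo the Hilbert ideal. -/
def componentToCoinv (d : ℤ) : homHarm b ρ ρ →ₗ[ℂ] homCoinvDeg b ρ d where
  toFun φ := ⟨⟨toCoinvariants b ρ ∘ₗ polyComponent n (d - 1) ∘ₗ φ.1, fun w m => by
      simp only [LinearMap.comp_apply]
      rw [φ.2.1 w m, polyComponent_polyAct, coinvAct_toCoinvariants]⟩,
    fun m => Submodule.mem_map_of_mem (polyComponent_mem _ _)⟩
  map_add' φ ψ := Subtype.ext (Subtype.ext (by ext m; simp))
  map_smul' c φ := Subtype.ext (Subtype.ext (by ext m; simp))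

/-- If the canonical map is an isomorphism `Sym(Hom_W(V, H)) ≅ ℂ[V]^W`: the projection
`ℂ[V]^W ≅ Sym(Hom_W(V, H)) ↠ Hom_W(V, H)_d → Hom_W(V, A)_d`. -/
def topProjection (hC : Function.Bijective (chevalleyMap b ρ)) (d : ℤ) :
    invariants b ρ →ₗ[ℂ] homCoinvDeg b ρ d :=
  componentToCoinv b ρ d ∘ₗ symLinearPart (homHarm b ρ ρ) ∘ₗ
    (AlgEquiv.ofBijective (chevalleyMap b ρ) hC).symm.toLinearMap

/-- The pairing `Hom_W(V, A) ⊗ Hom_W(V*, A) → Hom_W(V, A)_d`, obtained through `H ≅ A` from the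
multiplication pairing into `ℂ[V]^W` and the projection onto `Hom_W(V, A)_d`. -/
def dualityPairing (hA : Function.Bijective (harmonicsToCoinvariants b ρ))
    (hC : Function.Bijective (chevalleyMap b ρ)) (d : ℤ) :
    homCoinv b ρ ρ →ₗ[ℂ] homCoinv b ρ ρ.dual →ₗ[ℂ] homCoinvDeg b ρ d :=
  ((invariantPairing b ρ).compl₁₂ (liftHarm b ρ ρ hA) (liftHarm b ρ ρ.dual hA)).compr₂
    (topProjection b ρ hC d)

end Pairing

/-- A bilinear pairing `P × Q → L` is perfect if both maps `P → Hom(Q, L)` and `Q → Hom(P, L)`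
are isomorphisms. (Used for `L` one-dimensional.) -/
def IsPerfectPairing {P Q L : Type*} [AddCommMonoid P] [Module ℂ P]
    [AddCommMonoid Q] [Module ℂ Q] [AddCommMonoid L] [Module ℂ L] (B : P →ₗ[ℂ] Q →ₗ[ℂ] L) : Prop :=
  Function.Bijective B ∧ Function.Bijective B.flip

end ReflectionGroup

end

/-!
Write `S = ℂ[V]`, `I` for the Hilbert ideal and `H` for the harmonic polynomials. By definition, a
duality group has homogeneous bases of `n` elements for both `Hom_W(V, H)` and `Hom_W(V*, H)`, and
this count takes the place of the structure theory of reflection groups.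

*Harmonic polynomials and coinvariants.* For a `W`-invariant Hermitian form on `V` the Fischer form
on `S` is a `W`-invariant inner product for which multiplication by linear forms is adjoint to
differentiation. Hence `H` is the orthogonal complement of `I`, and `S = H ⊕ I` in each degree
(`bijective_harmonicsToCoinvariants`). By induction on the degree `S = S^W · H`, and, averaging,
`Hom_W(M, S) = S^W · Hom_W(M, H)` for every finite-dimensional representation `M`
(`exists_eq_sum_mul`).

*The invariants.* Expanding the differential of a homogeneous invariant `f` in a basis of
`Hom_W(V, H)` and contracting with the Euler field expresses `f` through the basic invariants and
invariants of smaller degree, so that the `n` basic invariants generate `S^W`. They are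
algebraically independent because `S` is integral over `S^W` (`bijective_chevalleyMap`).

*A regular vector.* By Schur's lemma only one codegree is zero, so only one degree equals `d`. By
the Nullstellensatz some `v ∈ V` is a zero of all basic invariants except for the one of degree `d`,
which takes the value `1` there. A homogeneous invariant of degree not divisible by `d` takes the
same value at `v` and at `ζ v`, where `ζ` is a primitive `d`-th root of unity, and hence vanishes at
`v`. The stabilizer of `v` is trivial (`eq_one_of_apply_eq`): otherwise there is a `W`-equivariant
polynomial vector field whose degree is `1` modulo `d`, which vanishes at `v` and whose derivative
at `v` is a nonzero multiple of the projection to the complement of the fixed space of the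
stabilizer. Expand it in a basis of `Hom_W(V*, H)`. All coefficients vanish at `v`, that of the
identity of `V*` because the vector field does and the others for degree reasons, and the
derivatives of the coefficients at `v` vanish on that complement, a contradiction. As the orbit of
`v` is free, evaluation at `v` is an isomorphism `Hom_W(M, H) ≅ M*` for `M = V` and `M = V*`
(`bijective_evalHom`).

*The pairing.* The coefficient of the basic invariant of degree `d` in the linear part of an
invariant `g` is the coefficient of `t ^ d` in `g (t v)` (`RegularFrame.topCoord_symLinearPart`).
The contraction of homogeneous `φ ∈ Hom_W(V, H)` and `ψ ∈ Hom_W(V*, H)` has degree strictly between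
`0` and `2 d`, so that this coefficient is the value at `v` of the contraction, whether or not its
degree is `d`. Under the evaluation isomorphisms the pairing therefore becomes the natural pairing
of `V*` with `V**`, which is perfect (`RegularFrame.topEquiv_dualityPairing`). It vanishes unless
the degrees add up to `d`, and so it is perfect in complementary degrees.
-/

noncomputable section

namespace ReflectionGroup

open MvPolynomial

/-! ### Homogeneous polynomials -/

section Graded

variable {n : ℕ}

lemma polyComponent_of_mem {j : ℤ} {f : MvPolynomial (Fin n) ℂ} (hf : f ∈ polyDeg n j) :
    polyComponent n j f = f := by
  cases j with
  | ofNat m => exact homogeneousComponent_eq_self hf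
  | negSucc m => exact ((Submodule.mem_bot ℂ).1 hf).symm

lemma polyComponent_of_mem_ne {j k : ℤ} (hjk : j ≠ k) {f : MvPolynomial (Fin n) ℂ}
    (hf : f ∈ polyDeg n j) : polyComponent n k f = 0 := by
  cases j with
  | negSucc m => rw [(Submodule.mem_bot ℂ).1 hf, map_zero]
  | ofNat m =>
    cases k with
    | negSucc l => rfl
    | ofNat l =>
      refine (homogeneousComponent_of_mem hf).trans (if_neg ?_)
      rintro rfl
      exact hjk rfl

lemma polyComponent_natCast (m : ℕ) : polyComponent n (m : ℤ) = homogeneousComponent m := rfl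

lemma exists_natCast_eq_of_mem_polyDeg {j : ℤ} {f : MvPolynomial (Fin n) ℂ}
    (hf : f ∈ polyDeg n j) (h0 : f ≠ 0) : ∃ m : ℕ, j = m := by
  cases j with
  | negSucc m => exact absurd ((Submodule.mem_bot ℂ).1 hf) h0
  | ofNat m => exact ⟨m, rfl⟩

lemma mul_mem_polyDeg {j k : ℤ} {f g : MvPolynomial (Fin n) ℂ} (hf : f ∈ polyDeg n j)
    (hg : g ∈ polyDeg n k) : f * g ∈ polyDeg n (j + k) := by
  by_cases hf0 : f = 0
  · rw [hf0, zero_mul]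
    exact zero_mem _
  by_cases hg0 : g = 0
  · rw [hg0, mul_zero]
    exact zero_mem _
  obtain ⟨m, rfl⟩ := exists_natCast_eq_of_mem_polyDeg hf hf0
  obtain ⟨l, rfl⟩ := exists_natCast_eq_of_mem_polyDeg hg hg0
  rw [← Nat.cast_add]
  exact IsHomogeneous.mul hf hg

lemma sum_polyComponent {N : ℕ} {f : MvPolynomial (Fin n) ℂ} (hN : f.totalDegree < N) :
    ∑ m ∈ Finset.range N, polyComponent n (m : ℤ) f = f := by
  conv_rhs => rw [← sum_homogeneousComponent f]
  refine (Finset.sum_subset (Finset.range_subset_range.2 hN) fun m _ hm => ?_).symm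
  exact homogeneousComponent_eq_zero _ _ (by simpa using hm)

/-- Multiplying by a homogeneous factor shifts homogeneous components. -/
lemma polyComponent_mul_of_mem {k : ℤ} {g : MvPolynomial (Fin n) ℂ} (hg : g ∈ polyDeg n k)
    (f : MvPolynomial (Fin n) ℂ) (j : ℤ) :
    polyComponent n j (f * g) = polyComponent n (j - k) f * g := by
  conv_lhs => rw [← sum_polyComponent (Nat.lt_succ_self f.totalDegree)]
  have key (m : ℕ) : polyComponent n j (polyComponent n (m : ℤ) f * g) =
      if j = m + k then polyComponent n (j - k) f * g else 0 := by
    have h := mul_mem_polyDeg (polyComponent_mem (m : ℤ) f) hg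
    split_ifs with hj
    · subst hj
      rw [polyComponent_of_mem h, add_sub_cancel_right]
    · exact polyComponent_of_mem_ne (Ne.symm hj) h
  rw [Finset.sum_mul, map_sum, Finset.sum_congr rfl fun m _ => key m]
  by_cases hj : ∃ m : ℕ, j = m + k
  · obtain ⟨m, hm⟩ := hj
    have hiff (l : ℕ) : j = l + k ↔ l = m := by omega
    simp only [hiff, Finset.sum_ite_eq', Finset.mem_range]
    split_ifs with h
    · rfl
    · rw [show j - k = (m : ℤ) by omega, polyComponent_natCast,
        homogeneousComponent_eq_zero _ _ (by omega), zero_mul]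
  · rw [Finset.sum_eq_zero fun m _ => if_neg fun h => hj ⟨m, h⟩]
    rcases h : j - k with m | m
    · exact absurd ⟨m, by simpa [sub_eq_iff_eq_add] using h⟩ hj
    · exact (zero_mul g).symm

instance finite_polyDeg (j : ℤ) : Module.Finite ℂ (polyDeg n j) := by
  cases j with
  | ofNat m => exact Module.Finite.iff_fg.2 (homogeneousSubmodule_fg (Fin n) ℂ m)
  | negSucc m => exact inferInstanceAs (Module.Finite ℂ (⊥ : Submodule ℂ _))

/-- Evaluating a homogeneous polynomial on a line. -/
lemma eval_smul_of_mem_polyDeg {m : ℕ} {f : MvPolynomial (Fin n) ℂ} (hf : f ∈ polyDeg n (m : ℤ))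
    (c : ℂ) (x : Fin n → ℂ) : eval (c • x) f = c ^ m * eval x f := by
  have h : f.IsHomogeneous m := hf
  rw [eval_eq, eval_eq, Finset.mul_sum]
  refine Finset.sum_congr rfl fun α hα => ?_
  have hdeg : ∑ i, α i = m := by
    have := h (mem_support_iff.1 hα)
    rwa [Finsupp.weight_apply, Finsupp.sum_fintype _ _ (by simp), Finset.sum_congr rfl
      (fun i _ => by simp : ∀ i ∈ Finset.univ, α i • (1 : Fin n → ℕ) i = α i)] at this
  simp only [Pi.smul_apply, smul_eq_mul, mul_pow]
  rw [← hdeg, ← Finset.prod_pow_eq_pow_sum]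
  rw [← Finset.prod_subset (Finset.subset_univ α.support) (f := fun i => c ^ α i) (by
    intro i _ hi
    simp [Finsupp.notMem_support_iff.1 hi]), Finset.prod_mul_distrib]
  ring

end Graded

/-! ### The action on polynomial functions, and averaging -/

section Action

variable {n : ℕ} {V W : Type*} [AddCommGroup V] [Module ℂ V] [Group W]
  (b : Module.Basis (Fin n) ℂ V) (ρ : Representation ℂ W V)

lemma algHom_ext_linearForm {A : Type*} [Semiring A] [Algebra ℂ A]
    {F G : MvPolynomial (Fin n) ℂ →ₐ[ℂ] A}
    (h : ∀ ξ, F (linearForm b ξ) = G (linearForm b ξ)) : F = G := by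
  refine MvPolynomial.algHom_ext fun i => ?_
  rw [← linearForm_coord b i]
  exact h _

lemma polyAct_one (f : MvPolynomial (Fin n) ℂ) : polyAct b ρ 1 f = f := by
  have : polyAct b ρ 1 = AlgHom.id ℂ _ := algHom_ext_linearForm b fun ξ => by
    rw [polyAct_linearForm, map_one]
    rfl
  rw [this]
  rfl

lemma polyAct_mul (w w' : W) (f : MvPolynomial (Fin n) ℂ) :
    polyAct b ρ (w * w') f = polyAct b ρ w (polyAct b ρ w' f) := by
  have : polyAct b ρ (w * w') = (polyAct b ρ w).comp (polyAct b ρ w') :=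
    algHom_ext_linearForm b fun ξ => by
      rw [AlgHom.comp_apply, polyAct_linearForm, polyAct_linearForm, polyAct_linearForm, map_mul]
      rfl
  rw [this]
  rfl

lemma polyAct_self_inv (w : W) (f : MvPolynomial (Fin n) ℂ) :
    polyAct b ρ w (polyAct b ρ w⁻¹ f) = f := by
  rw [← polyAct_mul, mul_inv_cancel, polyAct_one]

lemma polyAct_inv_self (w : W) (f : MvPolynomial (Fin n) ℂ) :
    polyAct b ρ w⁻¹ (polyAct b ρ w f) = f := by
  rw [← polyAct_mul, inv_mul_cancel, polyAct_one]

lemma dual_apply_eq_sum (ξ : Module.Dual ℂ V) (v : V) : ξ v = ∑ i, ξ (b i) * b.repr v i := by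
  conv_lhs => rw [← b.sum_repr v, map_sum]
  exact Finset.sum_congr rfl fun i _ => by rw [map_smul, smul_eq_mul, mul_comm]

/-- The value of a polynomial function at a point of `V`. -/
def evalAt (v : V) : MvPolynomial (Fin n) ℂ →ₐ[ℂ] ℂ := aeval fun i => b.coord i v

lemma evalAt_linearForm (v : V) (ξ : Module.Dual ℂ V) : evalAt b v (linearForm b ξ) = ξ v := by
  rw [dual_apply_eq_sum b ξ v]
  simp [linearForm, evalAt]

lemma evalAt_polyAct (v : V) (w : W) (f : MvPolynomial (Fin n) ℂ) :
    evalAt b v (polyAct b ρ w f) = evalAt b (ρ w⁻¹ v) f := by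
  have : (evalAt b v).comp (polyAct b ρ w) = evalAt b (ρ w⁻¹ v) :=
    algHom_ext_linearForm b fun ξ => by
      rw [AlgHom.comp_apply, polyAct_linearForm, evalAt_linearForm, evalAt_linearForm]
      rfl
  exact DFunLike.congr_fun this f

lemma evalAt_smul {m : ℕ} {f : MvPolynomial (Fin n) ℂ} (hf : f ∈ polyDeg n (m : ℤ))
    (c : ℂ) (v : V) : evalAt b (c • v) f = c ^ m * evalAt b v f := by
  have h (u : V) : evalAt b u f = eval (fun i => b.coord i u) f := rfl
  rw [h, h, ← eval_smul_of_mem_polyDeg hf]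
  congr 2
  ext i
  simp

lemma dirDeriv_linearForm (v : V) (ξ : Module.Dual ℂ V) :
    dirDeriv b v (linearForm b ξ) = C (ξ v) := by
  rw [dual_apply_eq_sum b ξ v]
  simp [linearForm, dirDeriv, mkDerivation_X, smul_eq_C_mul]

lemma dirDeriv_polyAct (w : W) (v : V) (f : MvPolynomial (Fin n) ℂ) :
    dirDeriv b (ρ w v) (polyAct b ρ w f) = polyAct b ρ w (dirDeriv b v f) := by
  induction f using MvPolynomial.induction_on with
  | C a => simp [← algebraMap_eq]
  | add p q hp hq => simp only [map_add, hp, hq]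
  | mul_X p i hp =>
    rw [map_mul, Derivation.leibniz, Derivation.leibniz, map_add, hp, ← linearForm_coord b i,
      polyAct_linearForm, dirDeriv_linearForm, dirDeriv_linearForm]
    simp only [smul_eq_mul, map_mul, polyAct_linearForm]
    congr 2
    rw [← algebraMap_eq, AlgHom.commutes, Representation.dual_apply,
      Module.Dual.transpose_apply, LinearMap.comp_apply, Representation.inv_self_apply]

lemma polyAct_mem_polyDeg (w : W) {j : ℤ} {f : MvPolynomial (Fin n) ℂ} (hf : f ∈ polyDeg n j) :
    polyAct b ρ w f ∈ polyDeg n j := by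
  rw [← polyComponent_of_mem hf, ← polyComponent_polyAct]
  exact polyComponent_mem _ _

lemma linearForm_mem_polyDeg (ξ : Module.Dual ℂ V) : linearForm b ξ ∈ polyDeg n 1 := by
  have h (i : Fin n) : (X i : MvPolynomial (Fin n) ℂ) ∈ polyDeg n 1 := isHomogeneous_X ℂ i
  exact Submodule.sum_mem (polyDeg n 1) fun i _ => Submodule.smul_mem _ (ξ (b i)) (h i)

lemma polyComponent_mem_invariants {f : MvPolynomial (Fin n) ℂ} (hf : f ∈ invariants b ρ)
    (j : ℤ) : polyComponent n j f ∈ invariants b ρ := fun w => by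
  rw [← polyComponent_polyAct, hf w]

lemma evalAt_apply_of_mem_invariants {g : MvPolynomial (Fin n) ℂ} (hg : g ∈ invariants b ρ) (w : W)
    (v : V) : evalAt b (ρ w v) g = evalAt b v g := by
  rw [← inv_inv w, ← evalAt_polyAct, hg]

lemma natCast_card_ne_zero (W : Type*) [Group W] [Fintype W] : (Fintype.card W : ℂ) ≠ 0 :=
  Nat.cast_ne_zero.2 Fintype.card_ne_zero

variable [Fintype W]

/-- The Reynolds operator: averaging over `W`. -/
def reynolds : MvPolynomial (Fin n) ℂ →ₗ[ℂ] MvPolynomial (Fin n) ℂ :=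
  (Fintype.card W : ℂ)⁻¹ • ∑ w, (polyAct b ρ w).toLinearMap

lemma reynolds_apply (f : MvPolynomial (Fin n) ℂ) :
    reynolds b ρ f = (Fintype.card W : ℂ)⁻¹ • ∑ w, polyAct b ρ w f := by
  simp [reynolds]

lemma reynolds_mem (f : MvPolynomial (Fin n) ℂ) : reynolds b ρ f ∈ invariants b ρ := fun w => by
  rw [reynolds_apply, map_smul, map_sum,
    ← Equiv.sum_comp (Equiv.mulLeft w) fun w' => polyAct b ρ w' f]
  simp_rw [← polyAct_mul, Equiv.coe_mulLeft]

lemma reynolds_mul {g : MvPolynomial (Fin n) ℂ} (hg : g ∈ invariants b ρ)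
    (f : MvPolynomial (Fin n) ℂ) : reynolds b ρ (f * g) = reynolds b ρ f * g := by
  rw [reynolds_apply, reynolds_apply, smul_mul_assoc, Finset.sum_mul]
  congr 1
  exact Finset.sum_congr rfl fun w _ => by rw [map_mul, hg w]

lemma reynolds_of_mem {g : MvPolynomial (Fin n) ℂ} (hg : g ∈ invariants b ρ) :
    reynolds b ρ g = g := by
  rw [reynolds_apply, Finset.sum_congr rfl fun w _ => hg w, Finset.sum_const, Finset.card_univ,
    ← Nat.cast_smul_eq_nsmul ℂ, smul_smul, inv_mul_cancel₀ (natCast_card_ne_zero W), one_smul]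

variable {M : Type*} [AddCommGroup M] [Module ℂ M] (σ : Representation ℂ W M)

/-- Averaging a linear map `M → ℂ[V]` over `W`, acting by conjugation. -/
def averageHom : (M →ₗ[ℂ] MvPolynomial (Fin n) ℂ) →ₗ[ℂ] (M →ₗ[ℂ] MvPolynomial (Fin n) ℂ) where
  toFun φ := (Fintype.card W : ℂ)⁻¹ • ∑ w, (polyAct b ρ w).toLinearMap ∘ₗ φ ∘ₗ σ w⁻¹
  map_add' φ ψ := by
    simp only [LinearMap.add_comp, LinearMap.comp_add, Finset.sum_add_distrib, smul_add]
  map_smul' c φ := by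
    simp only [LinearMap.smul_comp, LinearMap.comp_smul, ← Finset.smul_sum, RingHom.id_apply]
    rw [smul_comm]

lemma averageHom_apply (φ : M →ₗ[ℂ] MvPolynomial (Fin n) ℂ) (m : M) :
    averageHom b ρ σ φ m = (Fintype.card W : ℂ)⁻¹ • ∑ w, polyAct b ρ w (φ (σ w⁻¹ m)) := by
  simp [averageHom]

lemma averageHom_mem (φ : M →ₗ[ℂ] MvPolynomial (Fin n) ℂ) :
    averageHom b ρ σ φ ∈ homPoly b ρ σ := fun w m => by
  rw [averageHom_apply, averageHom_apply, map_smul, map_sum,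
    ← Equiv.sum_comp (Equiv.mulLeft w) fun w' => polyAct b ρ w' (φ (σ w'⁻¹ (σ w m)))]
  have key (w' : W) : polyAct b ρ (w * w') (φ (σ (w * w')⁻¹ (σ w m))) =
      polyAct b ρ w (polyAct b ρ w' (φ (σ w'⁻¹ m))) := by
    rw [polyAct_mul, mul_inv_rev, map_mul, Module.End.mul_apply, Representation.inv_self_apply]
  simp only [Equiv.coe_mulLeft, key]

lemma averageHom_of_mem {φ : M →ₗ[ℂ] MvPolynomial (Fin n) ℂ} (hφ : φ ∈ homPoly b ρ σ) :
    averageHom b ρ σ φ = φ := by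
  ext1 m
  rw [averageHom_apply, Finset.sum_congr rfl fun w _ => by
    rw [hφ w⁻¹ m, polyAct_self_inv], Finset.sum_const, Finset.card_univ,
    ← Nat.cast_smul_eq_nsmul ℂ, smul_smul, inv_mul_cancel₀ (natCast_card_ne_zero W), one_smul]

end Action

/-! ### The Fischer form -/

section FischerForm

variable {n : ℕ}

/-- The Fischer form `⟨f, g⟩ = ∑ α, α! conj(f_α) g_α` on polynomials, conjugate linear in `f`. -/
def fischer (f g : MvPolynomial (Fin n) ℂ) : ℂ :=
  ∑ α ∈ f.support, (∏ i, (α i).factorial : ℕ) * (starRingEnd ℂ (coeff α f) * coeff α g)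

lemma fischer_eq_sum {f : MvPolynomial (Fin n) ℂ} {s : Finset (Fin n →₀ ℕ)} (hs : f.support ⊆ s)
    (g : MvPolynomial (Fin n) ℂ) :
    fischer f g = ∑ α ∈ s, (∏ i, (α i).factorial : ℕ) *
      (starRingEnd ℂ (coeff α f) * coeff α g) := by
  refine Finset.sum_subset hs fun α _ hα => ?_
  rw [notMem_support_iff.1 hα, map_zero, zero_mul, mul_zero]

lemma fischer_add_left (f f' g : MvPolynomial (Fin n) ℂ) :
    fischer (f + f') g = fischer f g + fischer f' g := by
  classical
  rw [fischer_eq_sum (support_add (p := f) (q := f')),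
    fischer_eq_sum (Finset.subset_union_left (s₁ := f.support) (s₂ := f'.support)),
    fischer_eq_sum (Finset.subset_union_right (s₁ := f.support) (s₂ := f'.support)),
    ← Finset.sum_add_distrib]
  refine Finset.sum_congr rfl fun α _ => ?_
  rw [coeff_add, map_add]
  ring

lemma fischer_smul_left (f g : MvPolynomial (Fin n) ℂ) (c : ℂ) :
    fischer (c • f) g = starRingEnd ℂ c * fischer f g := by
  rw [fischer_eq_sum (support_smul (a := c) (f := f)), fischer, Finset.mul_sum]
  refine Finset.sum_congr rfl fun α _ => ?_
  rw [coeff_smul, smul_eq_mul, map_mul]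
  ring

lemma fischer_conj_symm (f g : MvPolynomial (Fin n) ℂ) :
    starRingEnd ℂ (fischer g f) = fischer f g := by
  classical
  rw [fischer_eq_sum (Finset.subset_union_left (s₁ := f.support) (s₂ := g.support)),
    fischer_eq_sum (Finset.subset_union_right (s₁ := f.support) (s₂ := g.support)), map_sum]
  refine Finset.sum_congr rfl fun α _ => ?_
  simp only [map_mul, Complex.conj_conj, map_natCast]
  ring

lemma fischer_self (f : MvPolynomial (Fin n) ℂ) :
    fischer f f = ((∑ α ∈ f.support, (∏ i, (α i).factorial : ℕ) *
      Complex.normSq (coeff α f) : ℝ) : ℂ) := by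
  rw [fischer, Complex.ofReal_sum]
  refine Finset.sum_congr rfl fun α _ => ?_
  rw [mul_comm (starRingEnd ℂ _), Complex.mul_conj]
  push_cast
  rfl

lemma fischer_self_nonneg (f : MvPolynomial (Fin n) ℂ) : 0 ≤ (fischer f f).re := by
  rw [fischer_self, Complex.ofReal_re]
  exact Finset.sum_nonneg fun α _ => mul_nonneg (Nat.cast_nonneg _) (Complex.normSq_nonneg _)

lemma eq_zero_of_fischer_self {f : MvPolynomial (Fin n) ℂ} (hf : fischer f f = 0) : f = 0 := by
  rw [fischer_self, Complex.ofReal_eq_zero, Finset.sum_eq_zero_iff_of_nonneg fun α _ =>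
    mul_nonneg (Nat.cast_nonneg _) (Complex.normSq_nonneg _)] at hf
  refine support_eq_empty.1 (Finset.eq_empty_of_forall_notMem fun α hα => ?_)
  rcases mul_eq_zero.1 (hf α hα) with h | h
  · exact (Finset.prod_pos fun i _ => Nat.factorial_pos (α i)).ne' (Nat.cast_eq_zero.1 h)
  · exact mem_support_iff.1 hα (Complex.normSq_eq_zero.1 h)

lemma fischer_monomial (α : Fin n →₀ ℕ) (c : ℂ) (g : MvPolynomial (Fin n) ℂ) :
    fischer (monomial α c) g =
      (∏ i, (α i).factorial : ℕ) * (starRingEnd ℂ c * coeff α g) := by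
  classical
  rw [fischer_eq_sum support_monomial_subset, Finset.sum_singleton, coeff_monomial, if_pos rfl]

/-- Multiplication by `x_i` and differentiation by `x_i` are adjoint for the Fischer form. -/
lemma fischer_X_mul (i : Fin n) (f g : MvPolynomial (Fin n) ℂ) :
    fischer (X i * f) g = fischer f (pderiv i g) := by
  induction f using MvPolynomial.induction_on' with
  | add p q hp hq => rw [mul_add, fischer_add_left, fischer_add_left, hp, hq]
  | monomial α c =>
    have hfac : ∏ j, ((α + Finsupp.single i 1 : Fin n →₀ ℕ) j).factorial =
        (α i + 1) * ∏ j, (α j).factorial := by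
      rw [← Finset.mul_prod_erase _ _ (Finset.mem_univ i),
        ← Finset.mul_prod_erase _ (fun j => (α j).factorial) (Finset.mem_univ i), ← mul_assoc]
      congr 1
      · simp [Nat.factorial_succ]
      · refine Finset.prod_congr rfl fun j hj => ?_
        simp [Finsupp.single_eq_of_ne (Finset.ne_of_mem_erase hj)]
    rw [mul_comm, X, monomial_mul, mul_one, fischer_monomial, fischer_monomial, coeff_pderiv, hfac]
    push_cast
    ring

lemma fischer_homogeneousComponent (m : ℕ) (f g : MvPolynomial (Fin n) ℂ) :
    fischer (homogeneousComponent m f) g = fischer f (homogeneousComponent m g) := by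
  have h : (homogeneousComponent m f).support ⊆ f.support := by
    rw [support_homogeneousComponent]
    exact Finset.filter_subset _ _
  rw [fischer_eq_sum h, fischer]
  refine Finset.sum_congr rfl fun α _ => ?_
  rw [coeff_homogeneousComponent, coeff_homogeneousComponent]
  split_ifs <;> simp

end FischerForm

/-! ### Unitary bases and changes of coordinates -/

section UnitaryBasis

variable {n : ℕ} {V W : Type*} [AddCommGroup V] [Module ℂ V] [Group W]
  (ρ : Representation ℂ W V)

/-- Every finite group of linear maps is unitary in a suitable basis: average the standard
Hermitian form over the group and take an orthonormal basis. -/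
lemma exists_unitary_basis (b : Module.Basis (Fin n) ℂ V) [Finite W] :
    ∃ e : Module.Basis (Fin n) ℂ V, ∀ w i j,
      e.coord i (ρ w⁻¹ (e j)) = starRingEnd ℂ (e.coord j (ρ w (e i))) := by
  have := Fintype.ofFinite W
  let cd : InnerProductSpace.Core ℂ V :=
    { inner := fun x y => ∑ w : W, ∑ i, starRingEnd ℂ (b.coord i (ρ w x)) * b.coord i (ρ w y)
      conj_inner_symm := fun x y => by
        simp only [map_sum, map_mul, Complex.conj_conj]
        exact Finset.sum_congr rfl fun w _ => Finset.sum_congr rfl fun i _ => mul_comm _ _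
      re_inner_nonneg := fun x => by
        simp only [RCLike.re_to_complex, Complex.re_sum, mul_comm (starRingEnd ℂ _),
          Complex.mul_conj, Complex.ofReal_re]
        exact Finset.sum_nonneg fun w _ => Finset.sum_nonneg fun i _ => Complex.normSq_nonneg _
      add_left := fun x y z => by
        simp only [map_add, add_mul, Finset.sum_add_distrib]
      smul_left := fun x y r => by
        simp only [map_smul, smul_eq_mul, map_mul, mul_assoc, ← Finset.mul_sum]
      definite := fun x hx => by
        simp only [mul_comm (starRingEnd ℂ _), Complex.mul_conj, ← Complex.ofReal_sum,
          Complex.ofReal_eq_zero] at hx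
        rw [Finset.sum_eq_zero_iff_of_nonneg fun w _ => Finset.sum_nonneg fun i _ =>
          Complex.normSq_nonneg _] at hx
        have h := hx 1 (Finset.mem_univ _)
        rw [Finset.sum_eq_zero_iff_of_nonneg fun i _ => Complex.normSq_nonneg _] at h
        refine b.ext_elem fun i => ?_
        have := Complex.normSq_eq_zero.1 (h i (Finset.mem_univ _))
        simpa using this }
  let _ : NormedAddCommGroup V := cd.toNormedAddCommGroup
  let _ : InnerProductSpace ℂ V := InnerProductSpace.ofCore cd.toCore
  have hfin : Module.Finite ℂ V := Module.Finite.of_basis b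
  have hn : Module.finrank ℂ V = n := by rw [Module.finrank_eq_card_basis b, Fintype.card_fin]
  have hinv (w : W) (x y : V) : inner ℂ (ρ w x) (ρ w y) = inner ℂ x y := by
    change (∑ w' : W, ∑ i, starRingEnd ℂ (b.coord i (ρ w' (ρ w x))) * b.coord i (ρ w' (ρ w y))) =
      ∑ w' : W, ∑ i, starRingEnd ℂ (b.coord i (ρ w' x)) * b.coord i (ρ w' y)
    rw [← Equiv.sum_comp (Equiv.mulRight w) fun w' => ∑ i, starRingEnd ℂ (b.coord i (ρ w' x)) *
      b.coord i (ρ w' y)]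
    simp only [Equiv.coe_mulRight, map_mul, Module.End.mul_apply]
  let e := (stdOrthonormalBasis ℂ V).reindex (finCongr hn)
  have hcoord (i : Fin n) (x : V) : e.toBasis.coord i x = inner ℂ (e i) x := by
    rw [Module.Basis.coord_apply, OrthonormalBasis.coe_toBasis_repr_apply,
      OrthonormalBasis.repr_apply_apply]
  refine ⟨e.toBasis, fun w i j => ?_⟩
  rw [hcoord, hcoord, inner_conj_symm, OrthonormalBasis.coe_toBasis, ← hinv w,
    Representation.self_inv_apply]

end UnitaryBasis

section ChangeOfBasis

variable {n : ℕ} {V : Type*} [AddCommGroup V] [Module ℂ V]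
  (b e : Module.Basis (Fin n) ℂ V)

/-- A polynomial function on `V` in the coordinates of `b`, rewritten in those of `e`. -/
def changeCoord : MvPolynomial (Fin n) ℂ →ₐ[ℂ] MvPolynomial (Fin n) ℂ :=
  aeval fun i => linearForm e (b.coord i)

lemma changeCoord_linearForm (ξ : Module.Dual ℂ V) :
    changeCoord b e (linearForm b ξ) = linearForm e ξ := by
  have h : ξ = ∑ i, ξ (b i) • b.coord i := b.ext fun j => by simp
  conv_rhs => rw [h, map_sum]
  simp [linearForm, changeCoord]

lemma changeCoord_changeCoord (f : MvPolynomial (Fin n) ℂ) :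
    changeCoord e b (changeCoord b e f) = f := by
  have : (changeCoord e b).comp (changeCoord b e) = AlgHom.id ℂ _ :=
    algHom_ext_linearForm b fun ξ => by
      rw [AlgHom.comp_apply, changeCoord_linearForm, changeCoord_linearForm, AlgHom.id_apply]
  exact DFunLike.congr_fun this f

lemma changeCoord_dirDeriv (v : V) (f : MvPolynomial (Fin n) ℂ) :
    changeCoord b e (dirDeriv b v f) = dirDeriv e v (changeCoord b e f) := by
  induction f using MvPolynomial.induction_on with
  | C a => simp [← algebraMap_eq]
  | add p q hp hq => simp only [map_add, hp, hq]
  | mul_X p i hp =>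
    rw [Derivation.leibniz, map_mul, Derivation.leibniz, map_add, ← linearForm_coord b i,
      changeCoord_linearForm, dirDeriv_linearForm, dirDeriv_linearForm, ← hp]
    simp only [smul_eq_mul, map_mul, changeCoord_linearForm]
    rw [← algebraMap_eq, AlgHom.commutes]

lemma changeCoord_mem_polyDeg {j : ℤ} {f : MvPolynomial (Fin n) ℂ} (hf : f ∈ polyDeg n j) :
    changeCoord b e f ∈ polyDeg n j := by
  cases j with
  | negSucc m => rw [(Submodule.mem_bot ℂ).1 hf, map_zero]; exact zero_mem _
  | ofNat m =>
    have h : f.IsHomogeneous m := hf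
    have h2 := h.aeval (fun i => linearForm e (b.coord i)) (n := 1) fun i =>
      linearForm_mem_polyDeg e (b.coord i)
    rwa [one_mul] at h2

lemma polyComponent_changeCoord (j : ℤ) (f : MvPolynomial (Fin n) ℂ) :
    polyComponent n j (changeCoord b e f) = changeCoord b e (polyComponent n j f) := by
  cases j with
  | negSucc m => exact (map_zero _).symm
  | ofNat m =>
    set N := max (f.totalDegree + 1) (m + 1)
    conv_lhs => rw [← sum_polyComponent (show f.totalDegree < N by omega)]
    rw [map_sum, map_sum, Finset.sum_eq_single_of_mem m (Finset.mem_range.2 (by omega))]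
    · exact polyComponent_of_mem (changeCoord_mem_polyDeg b e (polyComponent_mem _ _))
    · intro l _ hl
      exact polyComponent_of_mem_ne (by simpa using hl)
        (changeCoord_mem_polyDeg b e (polyComponent_mem _ _))

lemma dirDeriv_basis (i : Fin n) (f : MvPolynomial (Fin n) ℂ) :
    dirDeriv e (e i) f = pderiv i f := by
  classical
  rw [dirDeriv, pderiv_def]
  congr 2
  ext1 j
  simp [Finsupp.single_apply, Pi.single_apply, eq_comm]

end ChangeOfBasis

/-! ### Harmonic polynomials as orthogonal complement of the Hilbert ideal -/

section Apolarity

variable {n : ℕ} {V W : Type*} [AddCommGroup V] [Module ℂ V] [Group W]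
  (b e : Module.Basis (Fin n) ℂ V) (ρ : Representation ℂ W V)

/-- The Hermitian inner product on `ℂ[V]`, written in the coordinates of `b`, for which the
monomials in the coordinates of `e` are orthogonal: the Fischer form in the coordinates of `e`. -/
@[reducible]
def fischerCore : InnerProductSpace.Core ℂ (MvPolynomial (Fin n) ℂ) where
  inner f g := fischer (changeCoord b e f) (changeCoord b e g)
  conj_inner_symm _ _ := fischer_conj_symm _ _
  re_inner_nonneg _ := fischer_self_nonneg _
  add_left f f' g := by rw [map_add, fischer_add_left]
  smul_left f g c := by rw [map_smul, fischer_smul_left]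
  definite f hf := by
    rw [← changeCoord_changeCoord b e f, eq_zero_of_fischer_self hf, map_zero]

local notation "⟪" f "," g "⟫" => fischer (changeCoord b e f) (changeCoord b e g)

lemma fischer_add_right (f g g' : MvPolynomial (Fin n) ℂ) :
    fischer f (g + g') = fischer f g + fischer f g' := by
  rw [← fischer_conj_symm, fischer_add_left, map_add, fischer_conj_symm, fischer_conj_symm]

lemma fischer_smul_right (f g : MvPolynomial (Fin n) ℂ) (c : ℂ) :
    fischer f (c • g) = c * fischer f g := by
  rw [← fischer_conj_symm, fischer_smul_left, map_mul, fischer_conj_symm, Complex.conj_conj]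

lemma fischer_zero_right (f : MvPolynomial (Fin n) ℂ) : fischer f 0 = 0 := by
  rw [← zero_smul ℂ (0 : MvPolynomial (Fin n) ℂ), fischer_smul_right, zero_mul]

lemma fischer_zero_left (f : MvPolynomial (Fin n) ℂ) : fischer 0 f = 0 := by
  rw [← fischer_conj_symm, fischer_zero_right, map_zero]

lemma eq_of_forall_inner_eq {f g : MvPolynomial (Fin n) ℂ} (h : ∀ q, ⟪q, f⟫ = ⟪q, g⟫) :
    f = g := by
  have h0 : ⟪f - g, f - g⟫ = 0 := by
    have h2 : changeCoord b e (f - g) = changeCoord b e f + (-1 : ℂ) • changeCoord b e g := by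
      rw [map_sub, neg_one_smul, sub_eq_add_neg]
    rw [h2, fischer_add_right, fischer_smul_right, ← h2, h]
    ring
  exact sub_eq_zero.1 ((fischerCore b e).definite _ h0)

lemma inner_polyComponent (j : ℤ) (f g : MvPolynomial (Fin n) ℂ) :
    ⟪polyComponent n j f, g⟫ = ⟪f, polyComponent n j g⟫ := by
  rw [← polyComponent_changeCoord, ← polyComponent_changeCoord]
  cases j with
  | ofNat m => exact fischer_homogeneousComponent m _ _
  | negSucc m => exact (fischer_zero_left _).trans (fischer_zero_right _).symm

/-- The differential of a polynomial function: the map `v ↦ ∂_v f`. -/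
def gradient (f : MvPolynomial (Fin n) ℂ) : V →ₗ[ℂ] MvPolynomial (Fin n) ℂ where
  toFun v := dirDeriv b v f
  map_add' u v := by
    have : dirDeriv b (u + v) = dirDeriv b u + dirDeriv b v :=
      MvPolynomial.derivation_ext fun i => by simp [dirDeriv, mkDerivation_X]
    rw [this, Derivation.add_apply]
  map_smul' c v := by
    have : dirDeriv b (c • v) = c • dirDeriv b v :=
      MvPolynomial.derivation_ext fun i => by simp [dirDeriv, mkDerivation_X, smul_eq_C_mul]
    rw [this, Derivation.smul_apply, RingHom.id_apply]

lemma gradient_apply (f : MvPolynomial (Fin n) ℂ) (v : V) : gradient b f v = dirDeriv b v f := rfl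

/-- The vector of `V` corresponding to a linear form under the Hermitian form on `V` for which
`e` is orthonormal. -/
def riesz (ξ : Module.Dual ℂ V) : V := ∑ i, starRingEnd ℂ (ξ (e i)) • e i

lemma riesz_surjective (v : V) : ∃ ξ, riesz e ξ = v := by
  refine ⟨∑ i, starRingEnd ℂ (e.coord i v) • e.coord i, ?_⟩
  conv_rhs => rw [← e.sum_repr v]
  refine Finset.sum_congr rfl fun i _ => ?_
  congr 1
  simp [Finsupp.single_apply]

lemma inner_linearForm_mul (ξ : Module.Dual ℂ V) (f g : MvPolynomial (Fin n) ℂ) :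
    ⟪linearForm b ξ * f, g⟫ = ⟪f, dirDeriv b (riesz e ξ) g⟫ := by
  rw [map_mul, changeCoord_linearForm, changeCoord_dirDeriv]
  set f' := changeCoord b e f
  set g' := changeCoord b e g
  have h1 : dirDeriv e (riesz e ξ) g' = ∑ i, starRingEnd ℂ (ξ (e i)) • pderiv i g' := by
    rw [← gradient_apply, riesz, map_sum]
    exact Finset.sum_congr rfl fun i _ => by rw [map_smul, gradient_apply, dirDeriv_basis]
  have hleft (s : Finset (Fin n)) : fischer ((∑ i ∈ s, ξ (e i) • X i) * f') g' =
      fischer f' (∑ i ∈ s, starRingEnd ℂ (ξ (e i)) • pderiv i g') := by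
    classical
    induction s using Finset.induction_on with
    | empty => simp [fischer_zero_left, fischer_zero_right]
    | insert i s hi hs =>
      rw [Finset.sum_insert hi, Finset.sum_insert hi, add_mul, fischer_add_left, hs,
        fischer_add_right, smul_mul_assoc, fischer_smul_left, fischer_X_mul, fischer_smul_right]
  rw [h1, ← hleft]
  rfl

lemma riesz_dual {w : W} (he : ∀ w i j,
    e.coord i (ρ w⁻¹ (e j)) = starRingEnd ℂ (e.coord j (ρ w (e i)))) (ξ : Module.Dual ℂ V) :
    riesz e (ρ.dual w ξ) = ρ w (riesz e ξ) := by
  refine e.ext_elem fun i => ?_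
  have h (x : V) : ξ x = ∑ j, e.coord j x * ξ (e j) := by
    rw [dual_apply_eq_sum e ξ x]
    exact Finset.sum_congr rfl fun j _ => mul_comm _ _
  have h1 (η : Module.Dual ℂ V) : e.repr (riesz e η) i = starRingEnd ℂ (η (e i)) := by
    simp [riesz, Finsupp.single_apply]
  rw [h1, Representation.dual_apply, Module.Dual.transpose_apply, LinearMap.comp_apply, h]
  simp only [riesz, map_sum, map_mul, he, Complex.conj_conj, map_smul]
  simp [mul_comm]

lemma inner_polyAct (he : ∀ w i j,
    e.coord i (ρ w⁻¹ (e j)) = starRingEnd ℂ (e.coord j (ρ w (e i)))) (w : W)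
    (f g : MvPolynomial (Fin n) ℂ) : ⟪polyAct b ρ w f, polyAct b ρ w g⟫ = ⟪f, g⟫ := by
  induction f using MvPolynomial.induction_on generalizing g with
  | C a =>
    have hC : polyAct b ρ w (C a) = C a := by rw [← algebraMap_eq, AlgHom.commutes]
    have h0 : (C a : MvPolynomial (Fin n) ℂ) = polyComponent n 0 (C a) :=
      (polyComponent_of_mem (show C a ∈ polyDeg n 0 from isHomogeneous_C _ _)).symm
    have h1 : polyAct b ρ w (polyComponent n 0 g) = polyComponent n 0 g := by
      change polyAct b ρ w (homogeneousComponent 0 g) = homogeneousComponent 0 g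
      rw [homogeneousComponent_zero, ← algebraMap_eq, AlgHom.commutes]
    rw [hC, h0, inner_polyComponent, inner_polyComponent, polyComponent_polyAct, h1]
  | add p q hp hq => simp only [map_add, fischer_add_left] at *; rw [hp, hq]
  | mul_X p i hp =>
    rw [mul_comm, map_mul, ← linearForm_coord b i, polyAct_linearForm, inner_linearForm_mul,
      inner_linearForm_mul, riesz_dual e ρ he, dirDeriv_polyAct, hp]

/-- Multiplication by `p` and `D` are adjoint for the Hermitian form on `ℂ[V]`. -/
def IsFischerAdjoint (p : MvPolynomial (Fin n) ℂ)
    (D : Module.End ℂ (MvPolynomial (Fin n) ℂ)) : Prop :=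
  ∀ f g, ⟪p * f, g⟫ = ⟪f, D g⟫

lemma exists_isFischerAdjoint_op (p : MvPolynomial (Fin n) ℂ) :
    ∃ D ∈ constCoeffOps b, IsFischerAdjoint b e p D := by
  induction p using MvPolynomial.induction_on with
  | C a =>
    refine ⟨algebraMap ℂ _ (starRingEnd ℂ a), Subalgebra.algebraMap_mem _ _, fun f g => ?_⟩
    rw [Module.algebraMap_end_apply, map_smul, fischer_smul_right, ← smul_eq_C_mul, map_smul,
      fischer_smul_left]
  | add p q hp hq =>
    obtain ⟨D, hD, h⟩ := hp
    obtain ⟨E, hE, h'⟩ := hq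
    refine ⟨D + E, add_mem hD hE, fun f g => ?_⟩
    rw [add_mul, map_add, fischer_add_left, h, h', LinearMap.add_apply, map_add, fischer_add_right]
  | mul_X p i hp =>
    obtain ⟨D, hD, h⟩ := hp
    refine ⟨(dirDeriv b (riesz e (b.coord i))).toLinearMap * D,
      mul_mem (Algebra.subset_adjoin ⟨_, rfl⟩) hD, fun f g => ?_⟩
    rw [mul_assoc, h, ← linearForm_coord b i, inner_linearForm_mul]
    rfl

lemma exists_isFischerAdjoint_poly {D : Module.End ℂ (MvPolynomial (Fin n) ℂ)}
    (hD : D ∈ constCoeffOps b) : ∃ p, IsFischerAdjoint b e p D := by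
  induction hD using Algebra.adjoin_induction with
  | mem D hD =>
    obtain ⟨v, rfl⟩ := hD
    obtain ⟨ξ, rfl⟩ := riesz_surjective e v
    exact ⟨linearForm b ξ, inner_linearForm_mul b e ξ⟩
  | algebraMap c =>
    refine ⟨C (starRingEnd ℂ c), fun f g => ?_⟩
    rw [Module.algebraMap_end_apply, map_smul, fischer_smul_right, ← smul_eq_C_mul, map_smul,
      fischer_smul_left, Complex.conj_conj]
  | add D E _ _ hD hE =>
    obtain ⟨p, h⟩ := hD
    obtain ⟨q, h'⟩ := hE
    refine ⟨p + q, fun f g => ?_⟩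
    rw [add_mul, map_add, fischer_add_left, h, h', LinearMap.add_apply, map_add, fischer_add_right]
  | mul D E _ _ hD hE =>
    obtain ⟨p, h⟩ := hD
    obtain ⟨q, h'⟩ := hE
    refine ⟨q * p, fun f g => ?_⟩
    rw [mul_assoc, h', h, Module.End.mul_apply]

lemma IsFischerAdjoint.commute_iff {p : MvPolynomial (Fin n) ℂ}
    {D : Module.End ℂ (MvPolynomial (Fin n) ℂ)} (h : IsFischerAdjoint b e p D)
    (he : ∀ w i j, e.coord i (ρ w⁻¹ (e j)) = starRingEnd ℂ (e.coord j (ρ w (e i)))) :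
    (∀ w f, D (polyAct b ρ w f) = polyAct b ρ w (D f)) ↔ p ∈ invariants b ρ := by
  have hinv (w : W) (f g : MvPolynomial (Fin n) ℂ) :
      ⟪f, polyAct b ρ w g⟫ = ⟪polyAct b ρ w⁻¹ f, g⟫ := by
    rw [← inner_polyAct b e ρ he w⁻¹, polyAct_inv_self]
  constructor
  · intro hD w
    refine eq_of_forall_inner_eq b e fun q => ?_
    have h1 (q : MvPolynomial (Fin n) ℂ) : ⟪polyAct b ρ w p, q⟫ = ⟪p, q⟫ := by
      have h2 := h 1 (polyAct b ρ w⁻¹ q)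
      rw [mul_one, hinv w⁻¹, inv_inv] at h2
      rw [h2, hD, hinv, inv_inv, map_one, ← h, mul_one]
    rw [← fischer_conj_symm, h1, fischer_conj_symm]
  · intro hp w f
    refine eq_of_forall_inner_eq b e fun q => ?_
    rw [← h, hinv, map_mul, hp, h, hinv]

lemma IsFischerAdjoint.apply_one_eq_zero_iff {p : MvPolynomial (Fin n) ℂ}
    {D : Module.End ℂ (MvPolynomial (Fin n) ℂ)} (h : IsFischerAdjoint b e p D) :
    D 1 = 0 ↔ constantCoeff p = 0 := by
  have hcomp (f : MvPolynomial (Fin n) ℂ) : polyComponent n 0 f = C (constantCoeff f) :=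
    homogeneousComponent_zero f
  have h1 (f : MvPolynomial (Fin n) ℂ) : ⟪f, 1⟫ = ⟪C (constantCoeff f), 1⟫ := by
    rw [← hcomp, inner_polyComponent, hcomp, map_one constantCoeff, C_1]
  constructor
  · intro hD
    have h2 := h 1 1
    rw [hD, mul_one, map_zero, fischer_zero_right, h1, ← mul_one (C _), ← smul_eq_C_mul, map_smul,
      fischer_smul_left] at h2
    rcases mul_eq_zero.1 h2 with h3 | h3
    · exact (map_eq_zero _).1 h3
    · exact absurd ((fischerCore b e).definite _ h3) one_ne_zero
  · intro hp
    refine eq_of_forall_inner_eq b e fun q => ?_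
    rw [← h, h1, map_mul, hp, zero_mul, map_zero, map_zero, fischer_zero_left, fischer_zero_right]

/-- The harmonic polynomials are the orthogonal complement of the Hilbert ideal for an invariant
Hermitian form on `ℂ[V]`. -/
lemma mem_harmonics_iff (he : ∀ w i j,
    e.coord i (ρ w⁻¹ (e j)) = starRingEnd ℂ (e.coord j (ρ w (e i))))
    (q : MvPolynomial (Fin n) ℂ) : q ∈ harmonics b ρ ↔ ∀ f ∈ hilbertIdeal b ρ, ⟪f, q⟫ = 0 := by
  constructor
  · intro hq f hf
    suffices ∀ x, ⟪x * f, q⟫ = 0 by simpa using this 1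
    induction hf using Submodule.span_induction with
    | mem p hp =>
      obtain ⟨D, hD, h⟩ := exists_isFischerAdjoint_op b e p
      intro x
      rw [mul_comm, h, hq D hD ((h.commute_iff b e ρ he).2 hp.1)
        ((h.apply_one_eq_zero_iff b e).2 hp.2), map_zero, fischer_zero_right]
    | zero => intro x; rw [mul_zero, map_zero, fischer_zero_left]
    | add f g _ _ hf hg =>
      intro x
      rw [mul_add, map_add, fischer_add_left, hf, hg, add_zero]
    | smul a f _ hf =>
      intro x
      rw [smul_eq_mul, ← mul_assoc, hf]
  · intro hq D hD hDW hD1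
    obtain ⟨p, hp⟩ := exists_isFischerAdjoint_poly b e hD
    refine eq_of_forall_inner_eq b e fun f => ?_
    rw [← hp, map_zero, fischer_zero_right]
    exact hq _ (Ideal.mul_mem_right _ _ (Ideal.subset_span
      ⟨(hp.commute_iff b e ρ he).1 hDW, (hp.apply_one_eq_zero_iff b e).1 hD1⟩))

lemma polyComponent_mem_hilbertIdeal (j : ℤ) {f : MvPolynomial (Fin n) ℂ}
    (hf : f ∈ hilbertIdeal b ρ) : polyComponent n j f ∈ hilbertIdeal b ρ := by
  suffices ∀ x, polyComponent n j (x * f) ∈ hilbertIdeal b ρ by simpa using this 1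
  induction hf using Submodule.span_induction with
  | mem p hp =>
    intro x
    rw [← sum_polyComponent (Nat.lt_succ_self p.totalDegree), Finset.mul_sum, map_sum]
    refine sum_mem fun m _ => ?_
    rw [polyComponent_mul_of_mem (polyComponent_mem _ _)]
    refine Ideal.mul_mem_left _ _ (Ideal.subset_span
      ⟨polyComponent_mem_invariants b ρ hp.1 _, ?_⟩)
    have h0 : coeff 0 p = 0 := hp.2
    rw [polyComponent_natCast, constantCoeff_eq, coeff_homogeneousComponent, h0, ite_self]
  | zero => intro x; rw [mul_zero, map_zero]; exact zero_mem _
  | add f g _ _ hf hg =>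
    intro x
    rw [mul_add, map_add]
    exact add_mem (hf x) (hg x)
  | smul a f _ hf =>
    intro x
    rw [smul_eq_mul, ← mul_assoc]
    exact hf _

lemma polyComponent_mem_harmonics [Finite W] (j : ℤ) {f : MvPolynomial (Fin n) ℂ}
    (hf : f ∈ harmonics b ρ) : polyComponent n j f ∈ harmonics b ρ := by
  obtain ⟨e, he⟩ := exists_unitary_basis ρ b
  rw [mem_harmonics_iff b e ρ he] at hf ⊢
  intro g hg
  rw [← inner_polyComponent]
  exact hf _ (polyComponent_mem_hilbertIdeal b ρ j hg)

lemma eq_zero_of_mem_harmonics_of_mem_hilbertIdeal [Finite W] {f : MvPolynomial (Fin n) ℂ}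
    (hf : f ∈ harmonics b ρ) (hI : f ∈ hilbertIdeal b ρ) : f = 0 := by
  obtain ⟨e, he⟩ := exists_unitary_basis ρ b
  rw [mem_harmonics_iff b e ρ he] at hf
  exact (fischerCore b e).definite _ (hf f hI)

/-- Orthogonal projection onto the Hilbert ideal, in each degree. -/
lemma exists_mem_harmonics_sub_mem [Finite W] {j : ℤ} {f : MvPolynomial (Fin n) ℂ}
    (hf : f ∈ polyDeg n j) :
    ∃ h ∈ harmonics b ρ, h ∈ polyDeg n j ∧ f - h ∈ hilbertIdeal b ρ := by
  obtain ⟨e, he⟩ := exists_unitary_basis ρ b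
  let _ : NormedAddCommGroup (MvPolynomial (Fin n) ℂ) := (fischerCore b e).toNormedAddCommGroup
  let _ : InnerProductSpace ℂ (MvPolynomial (Fin n) ℂ) :=
    InnerProductSpace.ofCore (fischerCore b e).toCore
  let K : Submodule ℂ (MvPolynomial (Fin n) ℂ) :=
    polyDeg n j ⊓ (hilbertIdeal b ρ).restrictScalars ℂ
  have hK : FiniteDimensional ℂ K := Submodule.finiteDimensional_inf_left _ _
  obtain ⟨k, hk, h, hh, rfl⟩ := K.exists_add_mem_mem_orthogonal f
  have hhj : h ∈ polyDeg n j := by simpa using sub_mem hf hk.1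
  refine ⟨h, (mem_harmonics_iff b e ρ he h).2 fun g hg => ?_, hhj, by simpa using hk.2⟩
  rw [← polyComponent_of_mem hhj, ← inner_polyComponent]
  exact hh _ ⟨polyComponent_mem _ _, polyComponent_mem_hilbertIdeal b ρ j hg⟩

lemma toCoinvariants_eq_zero_iff (f : MvPolynomial (Fin n) ℂ) :
    toCoinvariants b ρ f = 0 ↔ f ∈ hilbertIdeal b ρ :=
  Ideal.Quotient.eq_zero_iff_mem

lemma exists_mem_harmonics_sub_mem' [Finite W] (f : MvPolynomial (Fin n) ℂ) :
    ∃ h ∈ harmonics b ρ, f - h ∈ hilbertIdeal b ρ := by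
  choose h hh _ hf using fun m : ℕ =>
    exists_mem_harmonics_sub_mem b ρ (polyComponent_mem (m : ℤ) f)
  refine ⟨∑ m ∈ Finset.range (f.totalDegree + 1), h m, sum_mem fun m _ => hh m, ?_⟩
  nth_rw 1 [← sum_polyComponent (Nat.lt_succ_self f.totalDegree), ← Finset.sum_sub_distrib]
  exact sum_mem fun m _ => hf m

theorem bijective_harmonicsToCoinvariants [Finite W] :
    Function.Bijective (harmonicsToCoinvariants b ρ) := by
  refine ⟨(injective_iff_map_eq_zero _).2 fun f hf => Subtype.ext ?_, fun a => ?_⟩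
  · exact eq_zero_of_mem_harmonics_of_mem_hilbertIdeal b ρ f.2
      ((toCoinvariants_eq_zero_iff b ρ _).1 hf)
  · obtain ⟨f, rfl⟩ := Ideal.Quotient.mk_surjective a
    obtain ⟨h, hh, hf⟩ := exists_mem_harmonics_sub_mem' b ρ f
    exact ⟨⟨h, hh⟩, (Ideal.Quotient.eq.2 hf).symm⟩

end Apolarity

/-! ### Generation over the invariants -/

section Generation

variable {n : ℕ} {V W M : Type*} [AddCommGroup V] [Module ℂ V] [Group W]
  [AddCommGroup M] [Module ℂ M]
  (b : Module.Basis (Fin n) ℂ V) (ρ : Representation ℂ W V) (σ : Representation ℂ W M)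

/-- The harmonic polynomials generate `ℂ[V]` as a module over the invariants. -/
lemma span_harmonics [Finite W] :
    Submodule.span (invariants b ρ) (harmonics b ρ : Set (MvPolynomial (Fin n) ℂ)) = ⊤ := by
  set N := Submodule.span (invariants b ρ) (harmonics b ρ : Set (MvPolynomial (Fin n) ℂ))
  have hmul {f g : MvPolynomial (Fin n) ℂ} (hf : f ∈ N) (hg : g ∈ invariants b ρ) : f * g ∈ N := by
    rw [mul_comm]
    exact N.smul_mem (⟨g, hg⟩ : invariants b ρ) hf
  have key (m : ℕ) : ∀ f ∈ polyDeg n (m : ℤ), f ∈ N := by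
    induction m using Nat.strong_induction_on with
    | _ m ih =>
      have hideal (f : MvPolynomial (Fin n) ℂ) (hf : f ∈ hilbertIdeal b ρ) :
          ∀ x, polyComponent n m (x * f) ∈ N := by
        induction hf using Submodule.span_induction with
        | mem p hp =>
          intro x
          rw [← sum_polyComponent (Nat.lt_succ_self p.totalDegree), Finset.mul_sum, map_sum]
          refine sum_mem fun l _ => ?_
          rw [polyComponent_mul_of_mem (polyComponent_mem _ _)]
          have h0 : coeff 0 p = 0 := hp.2
          rcases Nat.eq_zero_or_pos l with rfl | hl
          · rw [polyComponent_natCast 0, homogeneousComponent_zero, h0, C_0, mul_zero]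
            exact zero_mem _
          refine hmul ?_ (polyComponent_mem_invariants b ρ hp.1 _)
          rcases h : (m : ℤ) - l with k | k
          · exact ih k (by have : (m : ℤ) - l = k := h; omega) _ (polyComponent_mem (k : ℤ) x)
          · exact zero_mem N
        | zero => intro x; rw [mul_zero, map_zero]; exact zero_mem _
        | add f g _ _ hf hg =>
          intro x
          rw [mul_add, map_add]
          exact add_mem (hf x) (hg x)
        | smul a f _ hf =>
          intro x
          rw [smul_eq_mul, ← mul_assoc]
          exact hf _
      intro f hf
      obtain ⟨h, hh, hhm, hI⟩ := exists_mem_harmonics_sub_mem b ρ hf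
      have h1 := hideal _ hI 1
      rw [one_mul, polyComponent_of_mem (sub_mem hf hhm)] at h1
      simpa using add_mem h1 (Submodule.subset_span hh : h ∈ N)
  refine Submodule.eq_top_iff'.2 fun f => ?_
  rw [← sum_polyComponent (Nat.lt_succ_self f.totalDegree)]
  exact sum_mem fun m _ => key m _ (polyComponent_mem _ _)

lemma averageHom_mem_homHarm [Fintype W] {φ : M →ₗ[ℂ] MvPolynomial (Fin n) ℂ}
    (hφ : ∀ m, φ m ∈ harmonics b ρ) : averageHom b ρ σ φ ∈ homHarm b ρ σ := by
  refine ⟨averageHom_mem b ρ σ φ, fun m => ?_⟩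
  rw [averageHom_apply]
  exact Submodule.smul_mem _ _ (sum_mem fun w _ => polyAct_mem_harmonics b ρ w (hφ _))

/-- `Hom_W(M, H)` generates `Hom_W(M, ℂ[V])` as a module over the invariants. -/
lemma mem_span_homHarm [Finite W] [Module.Finite ℂ M] {φ : M →ₗ[ℂ] MvPolynomial (Fin n) ℂ}
    (hφ : φ ∈ homPoly b ρ σ) : φ ∈ Submodule.span (invariants b ρ)
      (homHarm b ρ σ : Set (M →ₗ[ℂ] MvPolynomial (Fin n) ℂ)) := by
  have := Fintype.ofFinite W
  have hav (g : invariants b ρ) (η : M →ₗ[ℂ] MvPolynomial (Fin n) ℂ) :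
      averageHom b ρ σ (g • η) = g • averageHom b ρ σ η := by
    ext1 m
    have hg (f : MvPolynomial (Fin n) ℂ) : g • f = g.1 * f := rfl
    have hterm (w : W) : polyAct b ρ w ((g • η) (σ w⁻¹ m)) =
        g • polyAct b ρ w (η (σ w⁻¹ m)) := by
      rw [LinearMap.smul_apply, hg, hg, map_mul, g.2 w]
    rw [LinearMap.smul_apply, averageHom_apply, averageHom_apply, Finset.sum_congr rfl
      fun w _ => hterm w, ← Finset.smul_sum, smul_comm]
  have hrank (ξ : Module.Dual ℂ M) (f : MvPolynomial (Fin n) ℂ) :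
      averageHom b ρ σ (ξ.smulRight f) ∈ Submodule.span (invariants b ρ)
        (homHarm b ρ σ : Set (M →ₗ[ℂ] MvPolynomial (Fin n) ℂ)) := by
    have hf : f ∈ Submodule.span (invariants b ρ)
        (harmonics b ρ : Set (MvPolynomial (Fin n) ℂ)) := by
      rw [span_harmonics]
      trivial
    induction hf using Submodule.span_induction with
    | mem h hh =>
      exact Submodule.subset_span (averageHom_mem_homHarm b ρ σ fun m =>
        Submodule.smul_mem _ _ hh)
    | zero =>
      have : ξ.smulRight (0 : MvPolynomial (Fin n) ℂ) = 0 := by ext; simp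
      rw [this, map_zero]
      exact zero_mem _
    | add f g _ _ hf hg =>
      have : ξ.smulRight (f + g) = ξ.smulRight f + ξ.smulRight g := by
        ext1 m
        simp
      rw [this, map_add]
      exact add_mem hf hg
    | smul g f _ hf =>
      have : ξ.smulRight (g • f) = g • ξ.smulRight f := by
        ext1 m
        exact smul_comm _ _ _
      rw [this, hav]
      exact Submodule.smul_mem _ _ hf
  let e := Module.finBasis ℂ M
  have hsum : φ = ∑ i, (e.coord i).smulRight (φ (e i)) := e.ext fun j => by
    simp [Finsupp.single_apply, ite_smul]
  rw [← averageHom_of_mem b ρ σ hφ, hsum, map_sum]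
  exact sum_mem fun i _ => hrank _ _

lemma exists_eq_sum_mul [Finite W] [Module.Finite ℂ M] {ι : Type*} [Fintype ι]
    (β : Module.Basis ι ℂ (homHarm b ρ σ)) {φ : M →ₗ[ℂ] MvPolynomial (Fin n) ℂ}
    (hφ : φ ∈ homPoly b ρ σ) : ∃ g : ι → MvPolynomial (Fin n) ℂ,
      (∀ i, g i ∈ invariants b ρ) ∧ ∀ m, φ m = ∑ i, g i * (β i).1 m := by
  have h1 : Submodule.span (invariants b ρ)
      (homHarm b ρ σ : Set (M →ₗ[ℂ] MvPolynomial (Fin n) ℂ)) ≤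
      Submodule.span (invariants b ρ) (Set.range fun i => (β i).1) := by
    refine Submodule.span_le.2 fun η hη => ?_
    have h2 : η = ∑ i, β.repr ⟨η, hη⟩ i • (β i).1 := by
      have := congrArg Subtype.val (β.sum_repr ⟨η, hη⟩)
      rw [AddSubmonoidClass.coe_finsetSum] at this
      exact this.symm
    rw [h2]
    refine sum_mem fun i _ => ?_
    rw [← algebraMap_smul (invariants b ρ)]
    exact Submodule.smul_mem _ _ (Submodule.subset_span ⟨i, rfl⟩)
  obtain ⟨g, hg⟩ := (Submodule.mem_span_range_iff_exists_fun _).1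
    (h1 (mem_span_homHarm b ρ σ hφ))
  refine ⟨fun i => (g i).1, fun i => (g i).2, fun m => ?_⟩
  rw [← hg, LinearMap.sum_apply]
  rfl

/-- A homogeneous equivariant map has homogeneous coefficients with respect to a homogeneous basis
of `Hom_W(M, H)`. -/
lemma exists_eq_sum_mul_of_mem_polyDeg [Finite W] [Module.Finite ℂ M] {ι : Type*} [Fintype ι]
    (β : Module.Basis ι ℂ (homHarm b ρ σ)) {u : ι → ℤ}
    (hβ : ∀ i m, (β i).1 m ∈ polyDeg n (u i)) {φ : M →ₗ[ℂ] MvPolynomial (Fin n) ℂ}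
    (hφ : φ ∈ homPoly b ρ σ) {D : ℤ} (hD : ∀ m, φ m ∈ polyDeg n D) :
    ∃ g : ι → MvPolynomial (Fin n) ℂ, (∀ i, g i ∈ invariants b ρ) ∧
      (∀ i, g i ∈ polyDeg n (D - u i)) ∧ ∀ m, φ m = ∑ i, g i * (β i).1 m := by
  obtain ⟨g, hg, h⟩ := exists_eq_sum_mul b ρ σ β hφ
  refine ⟨fun i => polyComponent n (D - u i) (g i), fun i =>
    polyComponent_mem_invariants b ρ (hg i) _, fun i => polyComponent_mem _ _, fun m => ?_⟩
  rw [← polyComponent_of_mem (hD m), h, map_sum]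
  exact Finset.sum_congr rfl fun i _ => polyComponent_mul_of_mem (hβ i m) _ _

end Generation

/-! ### The grading of `Hom_W(M, H)` -/

section Grading

variable {n : ℕ} {V W M : Type*} [AddCommGroup V] [Module ℂ V] [Group W]
  [AddCommGroup M] [Module ℂ M]
  (b : Module.Basis (Fin n) ℂ V) (ρ : Representation ℂ W V) (σ : Representation ℂ W M)

lemma polyComponent_comp_mem [Finite W] (j : ℤ) {φ : M →ₗ[ℂ] MvPolynomial (Fin n) ℂ}
    (hφ : φ ∈ homHarm b ρ σ) : polyComponent n j ∘ₗ φ ∈ homHarmTo b ρ σ j := by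
  refine ⟨⟨fun w m => ?_, fun m => polyComponent_mem_harmonics b ρ j (hφ.2 m)⟩,
    fun m => polyComponent_mem j _⟩
  rw [LinearMap.comp_apply, LinearMap.comp_apply, hφ.1, polyComponent_polyAct]

lemma exists_sum_polyComponent_comp [Module.Finite ℂ M] (φ : M →ₗ[ℂ] MvPolynomial (Fin n) ℂ) :
    ∃ N : ℕ, ∑ m ∈ Finset.range N, polyComponent n (m : ℤ) ∘ₗ φ = φ := by
  let e := Module.finBasis ℂ M
  refine ⟨(Finset.univ.sup fun i => (φ (e i)).totalDegree) + 1, e.ext fun i => ?_⟩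
  rw [LinearMap.sum_apply]
  exact sum_polyComponent (Nat.lt_succ_of_le
    (Finset.le_sup (f := fun i => (φ (e i)).totalDegree) (Finset.mem_univ i)))

instance finite_homHarmTo [Module.Finite ℂ M] (j : ℤ) : Module.Finite ℂ (homHarmTo b ρ σ j) := by
  let F : homHarmTo b ρ σ j →ₗ[ℂ] (M →ₗ[ℂ] polyDeg n j) :=
    { toFun := fun φ => φ.1.codRestrict (polyDeg n j) φ.2.2
      map_add' := fun _ _ => rfl
      map_smul' := fun _ _ => rfl }
  refine Module.Finite.of_injective F fun φ ψ h => Subtype.ext (LinearMap.ext fun m => ?_)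
  exact congrArg Subtype.val (LinearMap.congr_fun h m)

/-- A basis adapted to a decomposition with prescribed dimensions. The space `E` is only assumed to
be an additive monoid, for the lemma to apply to submodules with their inherited structure. -/
lemma exists_basis_of_iSupIndep {E ι : Type*} [AddCommMonoid E] [Module ℂ E] [Fintype ι]
    {A : ℤ → Submodule ℂ E} [∀ j, Module.Finite ℂ (A j)] (hindep : iSupIndep A)
    (htop : iSup A = ⊤) {u : ι → ℤ}
    (hu : ∀ j, Nat.card {i // u i = j} = Module.finrank ℂ (A j)) :
    ∃ β : Module.Basis ι ℂ E, ∀ i, β i ∈ A (u i) := by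
  let _ : AddCommGroup E := Module.addCommMonoidToAddCommGroup ℂ
  have hA := DirectSum.isInternal_submodule_of_iSupIndep_of_iSup_eq_top hindep htop
  have hbasis (j : ℤ) : Nonempty (Module.Basis {i // u i = j} ℂ (A j)) := by
    refine ⟨(Module.finBasis ℂ (A j)).reindex (Fintype.equivOfCardEq ?_)⟩
    rw [Fintype.card_fin, ← hu, Nat.card_eq_fintype_card]
  refine ⟨(hA.collectedBasis fun j => (hbasis j).some).reindex (Equiv.sigmaFiberEquiv u),
    fun i => ?_⟩
  rw [Module.Basis.reindex_apply]
  exact hA.collectedBasis_mem _ ((Equiv.sigmaFiberEquiv u).symm i)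

/-- The part of `Hom_W(M, H)` of maps with values in polynomials of degree `j`. -/
def homHarmDeg (j : ℤ) : Submodule ℂ (homHarm b ρ σ) :=
  (homHarmTo b ρ σ j).comap (homHarm b ρ σ).subtype

lemma mem_homHarmDeg {j : ℤ} {φ : homHarm b ρ σ} :
    φ ∈ homHarmDeg b ρ σ j ↔ φ.1 ∈ homHarmTo b ρ σ j := Iff.rfl

lemma mem_polyDeg_of_mem_homHarmDeg {j : ℤ} {φ : homHarm b ρ σ} (hφ : φ ∈ homHarmDeg b ρ σ j)
    (m : M) : φ.1 m ∈ polyDeg n j :=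
  ((mem_homHarmDeg b ρ σ).1 hφ).2 m

/-- The component of degree `j` of an element of `Hom_W(M, H)`, evaluated at `m`. -/
def homHarmComponent (j : ℤ) (m : M) : homHarm b ρ σ →ₗ[ℂ] MvPolynomial (Fin n) ℂ where
  toFun φ := polyComponent n j (φ.1 m)
  map_add' φ ψ := map_add (polyComponent n j) (φ.1 m) (ψ.1 m)
  map_smul' c φ := map_smul (polyComponent n j) c (φ.1 m)

lemma iSupIndep_homHarmDeg : iSupIndep (homHarmDeg b ρ σ) := by
  intro j
  refine Submodule.disjoint_def.2 fun φ hφ hφ' => Subtype.ext (LinearMap.ext fun m => ?_)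
  have hle : ⨆ k, ⨆ (_ : k ≠ j), homHarmDeg b ρ σ k ≤
      LinearMap.ker (homHarmComponent b ρ σ j m) := iSup₂_le fun k hk ψ hψ =>
    LinearMap.mem_ker.2 (polyComponent_of_mem_ne hk (mem_polyDeg_of_mem_homHarmDeg b ρ σ hψ m))
  have h1 : polyComponent n j (φ.1 m) = 0 := LinearMap.mem_ker.1 (hle hφ')
  rwa [polyComponent_of_mem (mem_polyDeg_of_mem_homHarmDeg b ρ σ hφ m)] at h1

lemma iSup_homHarmDeg [Finite W] [Module.Finite ℂ M] : iSup (homHarmDeg b ρ σ) = ⊤ := by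
  refine Submodule.eq_top_iff'.2 fun φ => ?_
  obtain ⟨N, hN⟩ := exists_sum_polyComponent_comp φ.1
  let η (m : ℕ) : homHarm b ρ σ := ⟨_, (polyComponent_comp_mem b ρ σ (m : ℤ) φ.2).1⟩
  have h1 : φ = ∑ m ∈ Finset.range N, η m := by
    refine Subtype.ext ?_
    rw [AddSubmonoidClass.coe_finsetSum]
    exact hN.symm
  rw [h1]
  refine sum_mem fun m _ => Submodule.mem_iSup_of_mem (m : ℤ) ?_
  exact polyComponent_comp_mem b ρ σ (m : ℤ) φ.2

/-- `Hom_W(M, H)_j` as a subspace of `Hom_W(M, H)` or as a space of maps. -/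
def homHarmDegEquiv (j : ℤ) : homHarmDeg b ρ σ j ≃ₗ[ℂ] homHarmTo b ρ σ j :=
  Submodule.comapSubtypeEquivOfLe fun _ hφ => hφ.1

instance finite_homHarmDeg [Module.Finite ℂ M] (j : ℤ) : Module.Finite ℂ (homHarmDeg b ρ σ j) :=
  Module.Finite.equiv (homHarmDegEquiv b ρ σ j).symm

/-- A homogeneous basis of `Hom_W(M, H)`, indexed by a list of degrees in which `j` occurs
`dim Hom_W(M, H_j)` times. -/
lemma exists_homogeneous_basis [Finite W] [Module.Finite ℂ M] {ι : Type*} [Fintype ι] {u : ι → ℤ}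
    (hu : ∀ j, Nat.card {i // u i = j} = Module.finrank ℂ (homHarmTo b ρ σ j)) :
    ∃ β : Module.Basis ι ℂ (homHarm b ρ σ), ∀ i, β i ∈ homHarmDeg b ρ σ (u i) :=
  exists_basis_of_iSupIndep (iSupIndep_homHarmDeg b ρ σ) (iSup_homHarmDeg b ρ σ) fun j =>
    (hu j).trans (homHarmDegEquiv b ρ σ j).finrank_eq.symm

end Grading

/-! ### Comparison of `Hom_W(M, A)` and `Hom_W(M, H)` -/

section Lift

variable {n : ℕ} {V W M : Type*} [AddCommGroup V] [Module ℂ V] [Group W]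
  [AddCommGroup M] [Module ℂ M]
  (b : Module.Basis (Fin n) ℂ V) (ρ : Representation ℂ W V) (σ : Representation ℂ W M)
  (hA : Function.Bijective (harmonicsToCoinvariants b ρ))

lemma toCoinvariants_liftHarm (φ : homCoinv b ρ σ) (m : M) :
    toCoinvariants b ρ ((liftHarm b ρ σ hA φ).1 m) = φ.1 m :=
  (LinearEquiv.ofBijective (harmonicsToCoinvariants b ρ) hA).apply_symm_apply (φ.1 m)

lemma eq_of_toCoinvariants_eq (hA : Function.Bijective (harmonicsToCoinvariants b ρ))
    {f g : MvPolynomial (Fin n) ℂ} (hf : f ∈ harmonics b ρ)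
    (hg : g ∈ harmonics b ρ) (h : toCoinvariants b ρ f = toCoinvariants b ρ g) : f = g :=
  congrArg Subtype.val (hA.1 (a₁ := ⟨f, hf⟩) (a₂ := ⟨g, hg⟩) h)

lemma bijective_liftHarm : Function.Bijective (liftHarm b ρ σ hA) := by
  refine ⟨fun φ ψ h => Subtype.ext (LinearMap.ext fun m => ?_), fun η => ?_⟩
  · rw [← toCoinvariants_liftHarm b ρ σ hA, h, toCoinvariants_liftHarm]
  · let φ : homCoinv b ρ σ := ⟨toCoinvariants b ρ ∘ₗ η.1, fun w m => by
      rw [LinearMap.comp_apply, η.2.1 w m, LinearMap.comp_apply, coinvAct_toCoinvariants]⟩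
    refine ⟨φ, Subtype.ext (LinearMap.ext fun m => ?_)⟩
    exact eq_of_toCoinvariants_eq b ρ hA ((liftHarm b ρ σ hA φ).2.2 m) (η.2.2 m)
      (toCoinvariants_liftHarm b ρ σ hA φ m)

lemma liftHarm_mem_iff [Finite W] (j : ℤ) (φ : homCoinv b ρ σ) :
    (liftHarm b ρ σ hA φ).1 ∈ homHarmTo b ρ σ j ↔ φ ∈ homCoinvTo b ρ σ j := by
  constructor
  · intro h m
    rw [← toCoinvariants_liftHarm b ρ σ hA]
    exact Submodule.mem_map_of_mem (h.2 m)
  · refine fun h => ⟨(liftHarm b ρ σ hA φ).2, fun m => ?_⟩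
    obtain ⟨f, hf, hfm⟩ := h m
    obtain ⟨q, hq, hqj, hI⟩ := exists_mem_harmonics_sub_mem b ρ hf
    have h1 : toCoinvariants b ρ q = φ.1 m := by
      rw [← hfm, eq_comm, ← sub_eq_zero, ← map_sub, toCoinvariants_eq_zero_iff]
      exact hI
    rwa [eq_of_toCoinvariants_eq b ρ hA ((liftHarm b ρ σ hA φ).2.2 m) hq
      ((toCoinvariants_liftHarm b ρ σ hA φ m).trans h1.symm)]

end Lift

/-! ### The algebra of invariants is a polynomial algebra -/

section Chevalley

variable {n : ℕ} {V W : Type*} [AddCommGroup V] [Module ℂ V] [Group W]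
  (b : Module.Basis (Fin n) ℂ V) (ρ : Representation ℂ W V)

lemma gradient_mem_homPoly {f : MvPolynomial (Fin n) ℂ} (hf : f ∈ invariants b ρ) :
    gradient b f ∈ homPoly b ρ ρ := fun w v => by
  rw [gradient_apply, gradient_apply, ← dirDeriv_polyAct, hf w]

lemma gradient_mem_polyDeg {m : ℕ} {f : MvPolynomial (Fin n) ℂ}
    (hf : f ∈ polyDeg n ((m + 1 : ℕ) : ℤ)) (v : V) : gradient b f v ∈ polyDeg n (m : ℤ) := by
  rw [← b.sum_repr v, map_sum]
  refine sum_mem fun i _ => ?_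
  rw [map_smul, gradient_apply, dirDeriv_basis]
  exact Submodule.smul_mem _ _ (IsHomogeneous.pderiv (i := i) (n := m + 1) hf)

/-- Euler's identity. -/
lemma contract_gradient {m : ℕ} {f : MvPolynomial (Fin n) ℂ} (hf : f ∈ polyDeg n (m : ℤ)) :
    contract b (gradient b f) (linearForm b) = (m : ℂ) • f := by
  rw [contract, Nat.cast_smul_eq_nsmul, ← IsHomogeneous.sum_X_mul_pderiv (n := m) hf]
  refine Finset.sum_congr rfl fun i _ => ?_
  rw [linearForm_coord, gradient_apply, dirDeriv_basis, mul_comm]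

variable {b ρ} in
lemma exists_natCast_degree {ι M : Type*} [AddCommGroup M] [Module ℂ M]
    {σ : Representation ℂ W M} (β : Module.Basis ι ℂ (homHarm b ρ σ)) {u : ι → ℤ}
    (hβ : ∀ i, β i ∈ homHarmDeg b ρ σ (u i)) (i : ι) : ∃ m : ℕ, u i = m := by
  by_contra h
  refine β.ne_zero i (Subtype.ext (LinearMap.ext fun m => ?_))
  by_contra h0
  exact h (exists_natCast_eq_of_mem_polyDeg (mem_polyDeg_of_mem_homHarmDeg b ρ σ (hβ i) m) h0)

/-- The invariants are generated by the `basicInvariant b ρ φ`: for a homogeneous invariant `f`,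
expand the differential of `f` in a basis of `Hom_W(V, H)`, contract with the Euler field and
induct on the degree. -/
lemma surjective_chevalleyMap [Finite W] {ι : Type*} [Fintype ι]
    (β : Module.Basis ι ℂ (homHarm b ρ ρ)) {u : ι → ℤ}
    (hβ : ∀ i, β i ∈ homHarmDeg b ρ ρ (u i)) : Function.Surjective (chevalleyMap b ρ) := by
  have hfin : Module.Finite ℂ V := Module.Finite.of_basis b
  have key (m : ℕ) : ∀ f : invariants b ρ, f.1 ∈ polyDeg n (m : ℤ) →
      f ∈ (chevalleyMap b ρ).range := by
    induction m using Nat.strong_induction_on with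
    | _ m ih =>
      intro f hf
      rcases m with _ | m
      · have h1 : f = algebraMap ℂ _ (coeff 0 f.1) := Subtype.ext <|
          (polyComponent_of_mem hf).symm.trans (homogeneousComponent_zero f.1)
        rw [h1]
        exact Subalgebra.algebraMap_mem _ _
      obtain ⟨g, hg, hgd, h⟩ := exists_eq_sum_mul_of_mem_polyDeg b ρ ρ β
        (fun i m => mem_polyDeg_of_mem_homHarmDeg b ρ ρ (hβ i) m) (gradient_mem_homPoly b ρ f.2)
        (gradient_mem_polyDeg b hf)
      have h2 : ((m + 1 : ℕ) : ℂ) • f = ∑ i, ⟨g i, hg i⟩ * basicInvariant b ρ (β i) := by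
        refine Subtype.ext ?_
        rw [AddSubmonoidClass.coe_finsetSum]
        change ((m + 1 : ℕ) : ℂ) • f.1 = ∑ i, g i * contract b (β i).1 (linearForm b)
        rw [← contract_gradient b hf, contract]
        simp only [contract, h, Finset.sum_mul, Finset.mul_sum, mul_assoc]
        exact Finset.sum_comm
      have h3 : ((m + 1 : ℕ) : ℂ) • f ∈ (chevalleyMap b ρ).range := by
        rw [h2]
        refine sum_mem fun i _ => mul_mem ?_ ⟨SymmetricAlgebra.ι ℂ _ (β i), by
          simp [chevalleyMap]⟩
        obtain ⟨k, hk⟩ := exists_natCast_degree β hβ i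
        rcases hl : (m : ℤ) - u i with l | l
        · have := hgd i
          rw [hl] at this
          exact ih l (by have : (m : ℤ) - u i = l := hl; omega) _ this
        · have := hgd i
          rw [hl] at this
          have h0 : (⟨g i, hg i⟩ : invariants b ρ) = 0 :=
            Subtype.ext ((Submodule.mem_bot ℂ).1 this)
          rw [h0]
          exact zero_mem _
      have h4 := Subalgebra.smul_mem _ h3 (((m + 1 : ℕ) : ℂ)⁻¹)
      rwa [smul_smul, inv_mul_cancel₀ (Nat.cast_ne_zero.2 m.succ_ne_zero), one_smul] at h4
  rw [← AlgHom.range_eq_top, eq_top_iff]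
  intro f _
  have h1 : f = ∑ m ∈ Finset.range (f.1.totalDegree + 1),
      ⟨_, polyComponent_mem_invariants b ρ f.2 (m : ℤ)⟩ := by
    refine Subtype.ext ?_
    rw [AddSubmonoidClass.coe_finsetSum]
    exact (sum_polyComponent (Nat.lt_succ_self _)).symm
  rw [h1]
  exact sum_mem fun m _ => key m _ (polyComponent_mem _ _)

lemma isIntegral_invariants [Finite W] :
    Algebra.IsIntegral (invariants b ρ) (MvPolynomial (Fin n) ℂ) := by
  let _ : MulSemiringAction W (MvPolynomial (Fin n) ℂ) :=
    { smul := fun w f => polyAct b ρ w f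
      one_smul := polyAct_one b ρ
      mul_smul := polyAct_mul b ρ
      smul_zero := fun w => map_zero _
      smul_add := fun w => map_add _
      smul_one := fun w => map_one _
      smul_mul := fun w => map_mul _ }
  have : Algebra.IsInvariant (invariants b ρ) (MvPolynomial (Fin n) ℂ) W :=
    ⟨fun f hf => ⟨⟨f, hf⟩, rfl⟩⟩
  exact Algebra.IsInvariant.isIntegral (invariants b ρ) (MvPolynomial (Fin n) ℂ) W

/-- `n` generators of the invariants are algebraically independent, because `ℂ[V]` is integral over
the invariants and has transcendence degree `n`. -/
theorem bijective_chevalleyMap [Finite W] (β : Module.Basis (Fin n) ℂ (homHarm b ρ ρ))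
    {u : Fin n → ℤ} (hβ : ∀ i, β i ∈ homHarmDeg b ρ ρ (u i)) :
    Function.Bijective (chevalleyMap b ρ) := by
  have hsurj := surjective_chevalleyMap b ρ β hβ
  refine ⟨?_, hsurj⟩
  let e := SymmetricAlgebra.equivMvPolynomial β
  let p (i : Fin n) : MvPolynomial (Fin n) ℂ := (basicInvariant b ρ (β i)).1
  have hp (G : MvPolynomial (Fin n) ℂ) : (chevalleyMap b ρ (e.symm G)).1 = aeval p G := by
    have : ((invariants b ρ).val.comp (chevalleyMap b ρ)).comp e.symm.toAlgHom = aeval p := by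
      refine MvPolynomial.algHom_ext fun i => ?_
      simp [e, p, chevalleyMap]
    exact DFunLike.congr_fun this G
  have hadj : Algebra.adjoin ℂ (Set.range p) = invariants b ρ := by
    rw [Algebra.adjoin_range_eq_range_aeval]
    ext f
    constructor
    · rintro ⟨G, rfl⟩
      change aeval p G ∈ _
      rw [← hp]
      exact (chevalleyMap b ρ _).2
    · intro hf
      obtain ⟨x, hx⟩ := hsurj ⟨f, hf⟩
      refine ⟨e x, ?_⟩
      change aeval p (e x) = f
      rw [← hp, AlgEquiv.symm_apply_apply, hx]
  have halg : Algebra.IsAlgebraic (Algebra.adjoin ℂ (Set.range p)) (MvPolynomial (Fin n) ℂ) := by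
    rw [hadj]
    have := isIntegral_invariants b ρ
    exact Algebra.IsIntegral.isAlgebraic
  have hind : AlgebraicIndependent ℂ p :=
    (Algebra.IsAlgebraic.isTranscendenceBasis_of_lift_le_trdeg_of_finite ℂ p
      (by rw [MvPolynomial.trdeg_of_isDomain]; simp)).1
  intro x y hxy
  have h1 : aeval p (e x) = aeval p (e y) := by
    rw [← hp, ← hp, AlgEquiv.symm_apply_apply, AlgEquiv.symm_apply_apply, hxy]
  exact e.injective (hind h1)

end Chevalley

/-! ### Schur's lemma -/

section Schur

variable {n : ℕ} {V W : Type*} [AddCommGroup V] [Module ℂ V] [Group W]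
  (b : Module.Basis (Fin n) ℂ V) (ρ : Representation ℂ W V)

lemma linearForm_injective : Function.Injective (linearForm b) := fun ξ η h => by
  ext v
  rw [← evalAt_linearForm b v ξ, h, evalAt_linearForm]

lemma exists_linearForm_eq {f : MvPolynomial (Fin n) ℂ} (hf : f ∈ polyDeg n 1) :
    ∃ ξ, linearForm b ξ = f := by
  have h1 : f ∈ homogeneousSubmodule (Fin n) ℂ 1 := hf
  rw [homogeneousSubmodule_one_eq_span_X] at h1
  have h2 : Submodule.span ℂ (Set.range X) ≤ LinearMap.range (linearForm b) := by
    rw [Submodule.span_le]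
    rintro _ ⟨i, rfl⟩
    exact ⟨b.coord i, linearForm_coord b i⟩
  exact h2 h1

/-- Schur's lemma: an equivariant map from `V*` to the linear polynomials is a multiple of the
identity of `V*`. -/
lemma exists_eq_smul_linearForm (hρ : ρ.IsIrreducible)
    {ψ : Module.Dual ℂ V →ₗ[ℂ] MvPolynomial (Fin n) ℂ} (hψ : ψ ∈ homPoly b ρ ρ.dual)
    (h1 : ∀ ξ, ψ ξ ∈ polyDeg n 1) : ∃ s : ℂ, ψ = s • linearForm b := by
  have hfin : Module.Finite ℂ V := Module.Finite.of_basis b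
  choose η hη using fun i => exists_linearForm_eq b (h1 (b.coord i))
  let S : V →ₗ[ℂ] V := ∑ i, (η i).smulRight (b i)
  have hS (ξ : Module.Dual ℂ V) : ψ ξ = linearForm b (ξ ∘ₗ S) := by
    have h2 : ξ = ∑ i, ξ (b i) • b.coord i := b.ext fun j => by simp
    have h3 : ξ ∘ₗ S = ∑ i, ξ (b i) • η i := by
      ext v
      simp [S, mul_comm]
    rw [h3]
    conv_lhs => rw [h2]
    simp only [map_sum, map_smul, hη]
  have hcomm (w : W) : S ∘ₗ ρ w = ρ w ∘ₗ S := by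
    have h2 (ξ : Module.Dual ℂ V) : ξ ∘ₗ (S ∘ₗ ρ w) = ξ ∘ₗ (ρ w ∘ₗ S) := by
      have h3 := hψ w⁻¹ ξ
      rw [hS, hS, polyAct_linearForm] at h3
      have h4 := linearForm_injective b h3
      rw [Representation.dual_apply, inv_inv] at h4
      exact h4.symm
    ext v
    refine b.ext_elem fun i => ?_
    exact LinearMap.congr_fun (h2 (b.coord i)) v
  let F : Representation.IntertwiningMap ρ ρ := ⟨S, hcomm⟩
  obtain ⟨s, hs⟩ :=
    (Representation.IsIrreducible.algebraMap_intertwiningMap_bijective_of_isAlgClosed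
      (ρ := ρ) (k := ℂ)).2 F
  have hSs : S = s • LinearMap.id := by
    have : F.toLinearMap = s • LinearMap.id := by
      rw [← hs]
      rfl
    exact this
  refine ⟨s, LinearMap.ext fun ξ => ?_⟩
  rw [hS, hSs, LinearMap.comp_smul, LinearMap.comp_id, map_smul, LinearMap.smul_apply]

end Schur

/-! ### Prescribed values of basic invariants -/

section Point

variable {n : ℕ} {V W : Type*} [AddCommGroup V] [Module ℂ V] [Group W]
  (b : Module.Basis (Fin n) ℂ V) (ρ : Representation ℂ W V)

/-- Basic invariants take arbitrary values: by the Reynolds operator, an ideal of `ℂ[V]` generated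
by invariants is proper if these generate a proper ideal of the invariants, and then it has a
zero. -/
lemma exists_evalAt_basicInvariant_eq [Finite W] (hC : Function.Bijective (chevalleyMap b ρ))
    {ι : Type*} [Fintype ι] (β : Module.Basis ι ℂ (homHarm b ρ ρ)) (y : ι → ℂ) :
    ∃ v : V, ∀ i, evalAt b v (basicInvariant b ρ (β i)).1 = y i := by
  have := Fintype.ofFinite W
  let q (i : ι) : MvPolynomial (Fin n) ℂ := (basicInvariant b ρ (β i)).1 - C (y i)
  have hq (i : ι) : q i ∈ invariants b ρ :=
    sub_mem (basicInvariant b ρ (β i)).2 (Subalgebra.algebraMap_mem _ _)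
  let J : Ideal (MvPolynomial (Fin n) ℂ) := Ideal.span (Set.range q)
  have hJ : J ≠ ⊤ := by
    rw [Ideal.ne_top_iff_one]
    intro h1
    obtain ⟨a, ha⟩ := (Ideal.mem_span_range_iff_exists_fun).1 h1
    let F : invariants b ρ →ₐ[ℂ] ℂ :=
      ((aeval y).comp (SymmetricAlgebra.equivMvPolynomial β).toAlgHom).comp
        (AlgEquiv.ofBijective (chevalleyMap b ρ) hC).symm.toAlgHom
    have hF (i : ι) : F (basicInvariant b ρ (β i)) = y i := by
      have h2 : basicInvariant b ρ (β i) = AlgEquiv.ofBijective (chevalleyMap b ρ) hC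
          (SymmetricAlgebra.ι ℂ _ (β i)) := by simp [chevalleyMap]
      rw [h2]
      simp [F]
    have h3 : (1 : invariants b ρ) =
        ∑ i, ⟨reynolds b ρ (a i), reynolds_mem b ρ _⟩ * ⟨q i, hq i⟩ := by
      refine Subtype.ext ?_
      rw [AddSubmonoidClass.coe_finsetSum]
      change 1 = ∑ i, reynolds b ρ (a i) * q i
      rw [Finset.sum_congr rfl fun i _ => (reynolds_mul b ρ (hq i) (a i)).symm, ← map_sum, ha,
        reynolds_of_mem b ρ (one_mem _)]
    have h4 (i : ι) : F ⟨q i, hq i⟩ = 0 := by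
      have : (⟨q i, hq i⟩ : invariants b ρ) =
          basicInvariant b ρ (β i) - algebraMap ℂ _ (y i) := rfl
      rw [this, map_sub, hF, AlgHom.commutes]
      exact sub_self _
    have h5 := congrArg F h3
    rw [map_one, map_sum, Finset.sum_eq_zero fun i _ => by rw [map_mul, h4, mul_zero]] at h5
    exact one_ne_zero h5
  have hne : (zeroLocus ℂ J).Nonempty := by
    by_contra h
    rw [Set.not_nonempty_iff_eq_empty] at h
    have h1 := vanishingIdeal_zeroLocus_eq_radical (K := ℂ) J
    rw [h, vanishingIdeal_empty] at h1
    exact hJ (Ideal.radical_eq_top.1 h1.symm)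
  obtain ⟨x, hx⟩ := hne
  refine ⟨b.equivFun.symm x, fun i => ?_⟩
  have h1 := hx (q i) (Ideal.subset_span ⟨i, rfl⟩)
  rw [map_sub, aeval_C, sub_eq_zero] at h1
  have h2 : evalAt b (b.equivFun.symm x) = aeval x := by
    rw [evalAt]
    congr 1
    ext i
    exact congrFun (b.equivFun.apply_symm_apply x) i
  rw [h2]
  exact h1

lemma contract_mem_polyDeg {j k : ℤ} {φ : V →ₗ[ℂ] MvPolynomial (Fin n) ℂ}
    {ψ : Module.Dual ℂ V →ₗ[ℂ] MvPolynomial (Fin n) ℂ} (hφ : ∀ v, φ v ∈ polyDeg n j)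
    (hψ : ∀ ξ, ψ ξ ∈ polyDeg n k) : contract b φ ψ ∈ polyDeg n (j + k) :=
  sum_mem fun _ _ => mul_mem_polyDeg (hφ _) (hψ _)

lemma basicInvariant_mem_polyDeg {j : ℤ} {φ : homHarm b ρ ρ} (hφ : φ ∈ homHarmDeg b ρ ρ j) :
    (basicInvariant b ρ φ).1 ∈ polyDeg n (j + 1) :=
  contract_mem_polyDeg b (mem_polyDeg_of_mem_homHarmDeg b ρ ρ hφ) (linearForm_mem_polyDeg b)

/-- If all basic invariants of degree not divisible by `d` vanish at `v`, then so do all invariants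
of degree not divisible by `d`: invariants take the same value at `v` and `ζ • v`, for `ζ` a
primitive `d`-th root of unity. -/
lemma evalAt_eq_zero_of_not_dvd (hC : Function.Surjective (chevalleyMap b ρ)) {ι : Type*}
    (β : Module.Basis ι ℂ (homHarm b ρ ρ)) {u : ι → ℤ}
    (hβ : ∀ i, β i ∈ homHarmDeg b ρ ρ (u i)) {d : ℕ} (hd : d ≠ 0) {v : V}
    (hv : ∀ i, ¬ (d : ℤ) ∣ u i + 1 → evalAt b v (basicInvariant b ρ (β i)).1 = 0)
    {g : MvPolynomial (Fin n) ℂ} (hg : g ∈ invariants b ρ) {e : ℤ} (he : ¬ (d : ℤ) ∣ e)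
    (hge : g ∈ polyDeg n e) : evalAt b v g = 0 := by
  have hζ := Complex.isPrimitiveRoot_exp d hd
  set ζ := Complex.exp (2 * Real.pi * Complex.I / d)
  have h1 : (((evalAt b (ζ • v)).comp (invariants b ρ).val).comp (chevalleyMap b ρ)) =
      (((evalAt b v).comp (invariants b ρ).val).comp (chevalleyMap b ρ)) := by
    refine SymmetricAlgebra.algHom_ext (β.ext fun i => ?_)
    have h2 : evalAt b (ζ • v) (basicInvariant b ρ (β i)).1 =
        evalAt b v (basicInvariant b ρ (β i)).1 := by
      obtain ⟨m, hm⟩ := exists_natCast_degree β hβ i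
      have h3 : (basicInvariant b ρ (β i)).1 ∈ polyDeg n ((m + 1 : ℕ) : ℤ) := by
        have := basicInvariant_mem_polyDeg b ρ (hβ i)
        rwa [hm] at this
      rw [evalAt_smul b h3]
      by_cases hdvd : (d : ℤ) ∣ u i + 1
      · rw [hm] at hdvd
        rw [(hζ.pow_eq_one_iff_dvd _).2 (by exact_mod_cast hdvd), one_mul]
      · rw [hv i hdvd, mul_zero]
    simpa [chevalleyMap] using h2
  obtain ⟨x, hx⟩ := hC ⟨g, hg⟩
  have h2 : evalAt b (ζ • v) g = evalAt b v g := by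
    have := DFunLike.congr_fun h1 x
    simp only [AlgHom.comp_apply, hx] at this
    exact this
  by_cases hg0 : g = 0
  · rw [hg0, map_zero]
  obtain ⟨m, rfl⟩ := exists_natCast_eq_of_mem_polyDeg hge hg0
  rw [evalAt_smul b hge] at h2
  by_contra h0
  have h3 : ζ ^ m = 1 := mul_right_cancel₀ h0 (by rw [h2, one_mul])
  exact he (by exact_mod_cast hζ.dvd_of_pow_eq_one m h3)

end Point

/-! ### Averaging over a stabilizer -/

section StabilizerAverage

variable {V W : Type*} [AddCommGroup V] [Module ℂ V] [Group W] [Fintype W]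
  (ρ : Representation ℂ W V) (v : V)

open Classical in
/-- The stabilizer of a vector, as a finite set. -/
def stab : Finset W := {w | ρ w v = v}

lemma mem_stab {w : W} : w ∈ stab ρ v ↔ ρ w v = v := by simp [stab]

lemma card_stab_ne_zero : ((stab ρ v).card : ℂ) ≠ 0 := by
  refine Nat.cast_ne_zero.2 (Finset.card_ne_zero_of_mem (a := (1 : W)) ?_)
  rw [mem_stab, map_one]
  rfl

/-- The projection of `V` onto the fixed space of the stabilizer of `v`. -/
def stabAverage : V →ₗ[ℂ] V := ((stab ρ v).card : ℂ)⁻¹ • ∑ c ∈ stab ρ v, ρ c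

lemma stabAverage_apply (x : V) :
    stabAverage ρ v x = ((stab ρ v).card : ℂ)⁻¹ • ∑ c ∈ stab ρ v, ρ c x := by
  simp [stabAverage]

lemma sum_stab_const {E : Type*} [AddCommGroup E] [Module ℂ E] {f : W → E} {x : E}
    (h : ∀ c ∈ stab ρ v, f c = x) :
    ((stab ρ v).card : ℂ)⁻¹ • ∑ c ∈ stab ρ v, f c = x := by
  rw [Finset.sum_congr rfl h, Finset.sum_const, ← Nat.cast_smul_eq_nsmul ℂ, smul_smul,
    inv_mul_cancel₀ (card_stab_ne_zero ρ v), one_smul]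

lemma stabAverage_self : stabAverage ρ v v = v := by
  rw [stabAverage_apply]
  exact sum_stab_const ρ v fun c hc => (mem_stab ρ v).1 hc

lemma apply_stabAverage {c : W} (hc : ρ c v = v) (x : V) :
    ρ c (stabAverage ρ v x) = stabAverage ρ v x := by
  rw [stabAverage_apply, map_smul, map_sum]
  congr 1
  have hc' : ρ c⁻¹ v = v := by rw [← hc, ρ.inv_self_apply, hc]
  refine Finset.sum_nbij' (fun w => c * w) (fun w => c⁻¹ * w) ?_ ?_ ?_ ?_ ?_
  · intro w hw
    rw [mem_stab] at hw ⊢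
    rw [map_mul, Module.End.mul_apply, hw, hc]
  · intro w hw
    rw [mem_stab] at hw ⊢
    rw [map_mul, Module.End.mul_apply, hw, hc']
  · intro w _
    exact inv_mul_cancel_left c w
  · intro w _
    exact mul_inv_cancel_left c w
  · intro w _
    rw [map_mul, Module.End.mul_apply]

lemma stabAverage_stabAverage (x : V) :
    stabAverage ρ v (stabAverage ρ v x) = stabAverage ρ v x := by
  conv_lhs => rw [stabAverage_apply]
  exact sum_stab_const ρ v fun c hc => apply_stabAverage ρ v ((mem_stab ρ v).1 hc) x

/-- The normalizer of the line of `v` commutes with the averaging over the stabilizer. -/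
lemma stabAverage_comm {w : W} {l : ℂ} (hw : ρ w v = l • v) (hl : l ≠ 0) (x : V) :
    stabAverage ρ v (ρ w x) = ρ w (stabAverage ρ v x) := by
  rw [stabAverage_apply, stabAverage_apply, map_smul, map_sum]
  congr 1
  have hw' : ρ w⁻¹ v = l⁻¹ • v := by
    have h := congrArg (ρ w⁻¹) hw
    rw [ρ.inv_self_apply, map_smul] at h
    exact (eq_inv_smul_iff₀ hl).2 h.symm
  refine Finset.sum_nbij' (fun c => w⁻¹ * c * w) (fun c => w * c * w⁻¹) ?_ ?_ ?_ ?_ ?_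
  · intro c hc
    rw [mem_stab] at hc ⊢
    rw [map_mul, map_mul, Module.End.mul_apply, Module.End.mul_apply, hw, map_smul, hc, map_smul,
      hw', smul_smul, mul_inv_cancel₀ hl, one_smul]
  · intro c hc
    rw [mem_stab] at hc ⊢
    rw [map_mul, map_mul, Module.End.mul_apply, Module.End.mul_apply, hw', map_smul, hc, map_smul,
      hw, smul_smul, inv_mul_cancel₀ hl, one_smul]
  · intro c _
    group
  · intro c _
    group
  · intro c _
    rw [map_mul, map_mul, Module.End.mul_apply, Module.End.mul_apply, ρ.self_inv_apply]

end StabilizerAverage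

/-! ### Regularity of the point, and evaluation of equivariant maps -/

section Regular

variable {n : ℕ} {V W : Type*} [AddCommGroup V] [Module ℂ V] [Group W]
  (b : Module.Basis (Fin n) ℂ V) (ρ : Representation ℂ W V)

/-- The derivative at `v` of an invariant is invariant under the stabilizer of `v`. -/
lemma evalAt_dirDeriv_stabAverage [Fintype W] {g : MvPolynomial (Fin n) ℂ}
    (hg : g ∈ invariants b ρ) (v y : V) :
    evalAt b v (dirDeriv b (stabAverage ρ v y) g) = evalAt b v (dirDeriv b y g) := by
  have h (c : W) (hc : c ∈ stab ρ v) :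
      evalAt b v (gradient b g (ρ c y)) = evalAt b v (gradient b g y) := by
    rw [mem_stab] at hc
    have hc' : ρ c⁻¹ v = v := by rw [← hc, ρ.inv_self_apply, hc]
    rw [gradient_mem_homPoly b ρ hg c y, evalAt_polyAct, hc']
  rw [← gradient_apply, stabAverage_apply, map_smul, map_sum, map_smul, map_sum]
  exact sum_stab_const ρ v h

lemma exists_dual_separating {v u : V} (h : v ∉ Submodule.span ℂ {u}) :
    ∃ ξ : Module.Dual ℂ V, ξ v = 1 ∧ ξ u = 0 := by
  obtain ⟨f, hf, hf'⟩ := Submodule.exists_dual_map_eq_bot_of_notMem h inferInstance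
  refine ⟨(f v)⁻¹ • f, ?_, ?_⟩
  · simp [hf]
  · have : f u ∈ (Submodule.span ℂ {u}).map f :=
      Submodule.mem_map_of_mem (Submodule.mem_span_singleton_self u)
    rw [hf', Submodule.mem_bot] at this
    simp [this]

/-- A homogeneous square, of degree divisible by `d`, which is `1` at `v` and vanishes at the
points of the orbit of `v` outside the line of `v`. -/
lemma exists_separating_homogeneous [Finite W] (v : V) (d : ℕ) :
    ∃ (h : MvPolynomial (Fin n) ℂ) (m : ℕ), (h ^ 2) ∈ polyDeg n ((d * m : ℕ) : ℤ) ∧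
      evalAt b v h = 1 ∧ (d ≠ 0 → ∀ w, v ∉ Submodule.span ℂ {ρ w v} → evalAt b (ρ w v) h = 0) := by
  classical
  have := Fintype.ofFinite W
  have hsep (w : W) : ∃ ξ : Module.Dual ℂ V, v ∉ Submodule.span ℂ {ρ w v} →
      ξ v = 1 ∧ ξ (ρ w v) = 0 := by
    by_cases h : v ∉ Submodule.span ℂ {ρ w v}
    · obtain ⟨ξ, hξ⟩ := exists_dual_separating h
      exact ⟨ξ, fun _ => hξ⟩
    · exact ⟨0, fun h' => absurd h' h⟩
  choose ξ hξ using hsep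
  let s : Finset W := {w | v ∉ Submodule.span ℂ {ρ w v}}
  refine ⟨∏ w ∈ s, linearForm b (ξ w) ^ d, 2 * s.card, ?_, ?_, fun hd w hw => ?_⟩
  · have h1 : (∏ w ∈ s, linearForm b (ξ w) ^ d).IsHomogeneous (∑ _w ∈ s, 1 * d) :=
      IsHomogeneous.prod _ _ _ fun w _ => IsHomogeneous.pow (linearForm_mem_polyDeg b (ξ w)) d
    have h2 := h1.pow 2
    rw [Finset.sum_const, smul_eq_mul, one_mul,
      show s.card * d * 2 = d * (2 * s.card) by ring] at h2
    exact h2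
  · rw [map_prod]
    refine Finset.prod_eq_one fun w hw => ?_
    rw [map_pow, evalAt_linearForm, (hξ w (by simpa [s] using hw)).1, one_pow]
  · rw [map_prod]
    refine Finset.prod_eq_zero (i := w) (by simpa [s] using hw) ?_
    rw [map_pow, evalAt_linearForm, (hξ w hw).2, zero_pow hd]

/-- Suppose that invariants of degree not divisible by `d` vanish at `v`, that `Hom_W(V*, H)` has a
homogeneous basis all of whose members, except for the identity of `V*`, have degree different from
`1` modulo `d`, and that some invariant of degree `d` does not vanish at `v`. Then the stabilizer of
`v` is trivial. Otherwise there would be another equivariant polynomial vector field of degree `1`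
modulo `d`, which near `v` is the projection to the complement of the fixed space of the
stabilizer. -/
theorem eq_one_of_apply_eq [Finite W] (hρ : Function.Injective ρ) {ι : Type*} [Fintype ι]
    (γ : Module.Basis ι ℂ (homHarm b ρ ρ.dual)) {u : ι → ℤ}
    (hγ : ∀ i, γ i ∈ homHarmDeg b ρ ρ.dual (u i)) {v : V} (hv0 : v ≠ 0) {d : ℕ} (hd : d ≠ 0)
    (hv : ∀ g ∈ invariants b ρ, ∀ e : ℤ, ¬ (d : ℤ) ∣ e → g ∈ polyDeg n e → evalAt b v g = 0)
    {f : MvPolynomial (Fin n) ℂ} (hf : f ∈ invariants b ρ) (hfd : f ∈ polyDeg n (d : ℤ))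
    (hfv : evalAt b v f ≠ 0) {t : ι} {s : ℂ} (hs : s ≠ 0) (ht : (γ t).1 = s • linearForm b)
    (hu : ∀ i ≠ t, ¬ (d : ℤ) ∣ u i - 1) {w : W} (hw : ρ w v = v) : w = 1 := by
  classical
  have := Fintype.ofFinite W
  have hfin : Module.Finite ℂ V := Module.Finite.of_basis b
  -- the projection `P` along the fixed space of the stabilizer
  let P : V →ₗ[ℂ] V := LinearMap.id - stabAverage ρ v
  have hP (x : V) : P x = x - stabAverage ρ v x := rfl
  have hPv : P v = 0 := by rw [hP, stabAverage_self, sub_self]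
  have hPP (x : V) : P (P x) = P x := by
    rw [hP (P x), hP, map_sub, stabAverage_stabAverage, sub_self, sub_zero]
  suffices hP0 : ∀ x, P x = 0 by
    have h1 (x : V) : stabAverage ρ v x = x := (sub_eq_zero.1 (hP0 x)).symm
    refine hρ (LinearMap.ext fun x => ?_)
    rw [map_one, Module.End.one_apply, ← h1 x, apply_stabAverage ρ v hw]
  obtain ⟨h, m, hdeg, hhv, hhw⟩ := exists_separating_homogeneous b ρ v d
  replace hhw := hhw hd
  -- the vector field `h² P`, and its average `ψ`
  let ψ₀ : Module.Dual ℂ V →ₗ[ℂ] MvPolynomial (Fin n) ℂ :=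
    LinearMap.mulLeft ℂ (h ^ 2) ∘ₗ linearForm b ∘ₗ Module.Dual.transpose P
  have hψ₀ (ξ : Module.Dual ℂ V) : ψ₀ ξ = h ^ 2 * linearForm b (ξ ∘ₗ P) := rfl
  let ψ := averageHom b ρ ρ.dual ψ₀
  have hψ : ψ ∈ homPoly b ρ ρ.dual := averageHom_mem b ρ _ _
  have hψd (ξ : Module.Dual ℂ V) : ψ ξ ∈ polyDeg n ((d * m : ℕ) + 1 : ℤ) := by
    rw [averageHom_apply]
    refine Submodule.smul_mem _ _ (sum_mem fun w _ => polyAct_mem_polyDeg b ρ w ?_)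
    exact mul_mem_polyDeg hdeg (linearForm_mem_polyDeg b _)
  -- elements of `W` moving `v` inside its line
  have hline (w : W) (h1 : v ∈ Submodule.span ℂ {ρ w v}) :
      ∃ l : ℂ, ρ w v = l • v ∧ l ^ d = 1 := by
    obtain ⟨l, hl⟩ := Submodule.mem_span_singleton.1 h1
    have hl0 : l ≠ 0 := by
      rintro rfl
      rw [zero_smul] at hl
      exact hv0 hl.symm
    have h2 : ρ w v = l⁻¹ • v := (eq_inv_smul_iff₀ hl0).2 hl
    refine ⟨l⁻¹, h2, ?_⟩
    have h3 := evalAt_apply_of_mem_invariants b ρ hf w v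
    rw [h2, evalAt_smul b hfd] at h3
    exact mul_right_cancel₀ hfv (by rw [h3, one_mul])
  have hl_ne {l : ℂ} (hl : l ^ d = 1) : l ≠ 0 := by
    rintro rfl
    rw [zero_pow hd] at hl
    exact zero_ne_one hl
  have hh1 {l : ℂ} (hl : l ^ d = 1) : evalAt b (l • v) (h ^ 2) = 1 := by
    rw [evalAt_smul b hdeg, map_pow, hhv, one_pow, mul_one, pow_mul, hl, one_pow]
  have hdual (w : W) (ξ : Module.Dual ℂ V) (x : V) : ρ.dual w⁻¹ ξ x = ξ (ρ w x) := by
    rw [Representation.dual_apply, inv_inv]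
    rfl
  -- `ψ` vanishes at `v`
  have hterm (w : W) (ξ : Module.Dual ℂ V) :
      evalAt b v (polyAct b ρ w (ψ₀ (ρ.dual w⁻¹ ξ))) = 0 := by
    rw [evalAt_polyAct, hψ₀, map_mul, evalAt_linearForm, LinearMap.comp_apply]
    by_cases h1 : v ∈ Submodule.span ℂ {ρ w⁻¹ v}
    · obtain ⟨l, hl, -⟩ := hline _ h1
      rw [hl, map_smul, hPv, smul_zero, map_zero, mul_zero]
    · rw [map_pow, hhw _ h1, zero_pow two_ne_zero, zero_mul]
  have hψv (ξ : Module.Dual ℂ V) : evalAt b v (ψ ξ) = 0 := by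
    rw [averageHom_apply, map_smul, map_sum, Finset.sum_eq_zero fun w _ => hterm w ξ, smul_zero]
  -- the derivative of `ψ` at `v` is a nonzero multiple of `P`
  let N : Finset W := {w | v ∈ Submodule.span ℂ {ρ w⁻¹ v}}
  have hterm' (w : W) (ξ : Module.Dual ℂ V) (y : V) :
      evalAt b v (dirDeriv b y (polyAct b ρ w (ψ₀ (ρ.dual w⁻¹ ξ)))) =
        if w ∈ N then ξ (P y) else 0 := by
    have h1 := dirDeriv_polyAct b ρ w (ρ w⁻¹ y) (ψ₀ (ρ.dual w⁻¹ ξ))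
    rw [ρ.self_inv_apply] at h1
    rw [h1, evalAt_polyAct, hψ₀, Derivation.leibniz, smul_eq_mul, smul_eq_mul, map_add, map_mul,
      map_mul, dirDeriv_linearForm, evalAt_linearForm, LinearMap.comp_apply, LinearMap.comp_apply]
    rw [← algebraMap_eq, AlgHom.commutes]
    change _ * (ρ.dual w⁻¹ ξ (P (ρ w⁻¹ y))) + _ = _
    by_cases h2 : v ∈ Submodule.span ℂ {ρ w⁻¹ v}
    · obtain ⟨l, hl, hld⟩ := hline _ h2
      have hcomm : ρ w (P (ρ w⁻¹ y)) = P y := by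
        rw [hP, stabAverage_comm ρ v hl (hl_ne hld), ← map_sub, ρ.self_inv_apply]
        rfl
      rw [if_pos (by simpa [N] using h2), hl, map_smul, hPv, smul_zero, map_zero, zero_mul,
        add_zero, hh1 hld, one_mul, hdual, hcomm]
    · rw [if_neg (by simpa [N] using h2), pow_two, Derivation.leibniz, smul_eq_mul, map_add,
        map_mul, map_mul, hhw _ h2]
      ring
  have hN : (N.card : ℂ) ≠ 0 := by
    refine Nat.cast_ne_zero.2 (Finset.card_ne_zero_of_mem (a := (1 : W)) ?_)
    simp [N, Submodule.mem_span_singleton_self]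
  have hderiv (ξ : Module.Dual ℂ V) (y : V) : evalAt b v (dirDeriv b y (ψ ξ)) =
      (Fintype.card W : ℂ)⁻¹ * (N.card * ξ (P y)) := by
    rw [averageHom_apply, Derivation.map_smul, map_sum, map_smul, map_sum,
      Finset.sum_congr rfl fun w _ => hterm' w ξ y, Finset.sum_ite_mem, Finset.univ_inter,
      Finset.sum_const, nsmul_eq_mul, smul_eq_mul]
  -- the coefficients of `ψ` in the basis `γ` vanish at `v`
  obtain ⟨g, hg, hgd, hψg⟩ := exists_eq_sum_mul_of_mem_polyDeg b ρ ρ.dual γ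
    (fun i ξ => mem_polyDeg_of_mem_homHarmDeg b ρ ρ.dual (hγ i) ξ) hψ hψd
  have hgi (i : ι) (hi : i ≠ t) : evalAt b v (g i) = 0 := by
    refine hv _ (hg i) _ (fun h1 => hu i hi ?_) (hgd i)
    have h2 : (d : ℤ) ∣ ((d * m : ℕ) : ℤ) := ⟨m, by push_cast; ring⟩
    have h3 := dvd_sub h2 h1
    rwa [show ((d * m : ℕ) : ℤ) - (((d * m : ℕ) : ℤ) + 1 - u i) = u i - 1 by ring] at h3
  have hgt : evalAt b v (g t) = 0 := by
    obtain ⟨ξ, hξ⟩ := Module.Projective.exists_dual_eq_one ℂ hv0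
    have h1 := hψv ξ
    rw [hψg, map_sum, Finset.sum_eq_single_of_mem t (Finset.mem_univ t) fun i _ hi => by
      rw [map_mul, hgi i hi, zero_mul], ht, map_mul, LinearMap.smul_apply, map_smul,
      evalAt_linearForm, hξ, smul_eq_mul, mul_one] at h1
    exact (mul_eq_zero.1 h1).resolve_right hs
  have hg0 (i : ι) : evalAt b v (g i) = 0 := by
    by_cases hi : i = t
    · rw [hi, hgt]
    · exact hgi i hi
  intro x
  refine b.ext_elem fun i => ?_
  have h1 := hderiv (b.coord i) (P x)
  have h2 (j : ι) : evalAt b v (dirDeriv b (P x) (g j)) = 0 := by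
    rw [← gradient_apply, hP, map_sub, map_sub, gradient_apply, gradient_apply,
      evalAt_dirDeriv_stabAverage b ρ (hg j), sub_self]
  rw [hψg, map_sum, map_sum, Finset.sum_eq_zero fun j _ => by
    rw [Derivation.leibniz, smul_eq_mul, smul_eq_mul, map_add, map_mul, map_mul, h2, hg0, zero_mul,
      mul_zero, add_zero], hPP] at h1
  have h3 := (mul_eq_zero.1 ((mul_eq_zero.1 h1.symm).resolve_left
    (inv_ne_zero (natCast_card_ne_zero W)))).resolve_left hN
  rw [map_zero]
  exact h3

/-- At a point with trivial stabilizer, equivariant maps take arbitrary values. -/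
lemma exists_homPoly_evalAt_eq [Finite W] {M : Type*} [AddCommGroup M] [Module ℂ M]
    (σ : Representation ℂ W M) {v : V} (hv : ∀ w, ρ w v = v → w = 1) (l : Module.Dual ℂ M) :
    ∃ φ ∈ homPoly b ρ σ, ∀ m, evalAt b v (φ m) = l m := by
  classical
  have := Fintype.ofFinite W
  have hsep (w : W) : ∃ ξ : Module.Dual ℂ V, w ≠ 1 → ξ v ≠ ξ (ρ w v) := by
    by_cases hw : w = 1
    · exact ⟨0, fun h => absurd hw h⟩
    · have h1 : v - ρ w v ≠ 0 := fun h => hw (hv w (sub_eq_zero.1 h).symm)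
      obtain ⟨ξ, hξ⟩ := Module.Projective.exists_dual_ne_zero ℂ h1
      exact ⟨ξ, fun _ => by rwa [map_sub, sub_ne_zero] at hξ⟩
  choose ξ hξ using hsep
  let h : MvPolynomial (Fin n) ℂ :=
    ∏ w ∈ Finset.univ.erase (1 : W), (linearForm b (ξ w) - C (ξ w (ρ w v)))
  have hlin (x : V) (w : W) : evalAt b x (linearForm b (ξ w) - C (ξ w (ρ w v))) =
      ξ w x - ξ w (ρ w v) := by
    rw [map_sub, evalAt_linearForm, ← algebraMap_eq, AlgHom.commutes]
    rfl
  have hhv : evalAt b v h ≠ 0 := by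
    rw [map_prod, Finset.prod_ne_zero_iff]
    intro w hw
    rw [hlin, sub_ne_zero]
    exact hξ w (Finset.ne_of_mem_erase hw)
  have hhw (w : W) (hw : w ≠ 1) : evalAt b (ρ w v) h = 0 := by
    rw [map_prod]
    refine Finset.prod_eq_zero (i := w) (Finset.mem_erase.2 ⟨hw, Finset.mem_univ w⟩) ?_
    rw [hlin, sub_self]
  refine ⟨averageHom b ρ σ (((Fintype.card W : ℂ) * (evalAt b v h)⁻¹) • l.smulRight h),
    averageHom_mem b ρ σ _, fun m => ?_⟩
  rw [averageHom_apply, map_smul, map_sum, Finset.sum_eq_single_of_mem 1 (Finset.mem_univ 1)]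
  · have h1 : ρ (1⁻¹ : W) v = v := by rw [inv_one, map_one]; rfl
    have h2 : σ (1⁻¹ : W) m = m := by rw [inv_one, map_one]; rfl
    rw [evalAt_polyAct, h1, h2, LinearMap.smul_apply, LinearMap.smulRight_apply, map_smul,
      map_smul, smul_eq_mul, smul_eq_mul, smul_eq_mul]
    field_simp [natCast_card_ne_zero W]
  · intro w _ hw
    rw [evalAt_polyAct, LinearMap.smul_apply, LinearMap.smulRight_apply, map_smul, map_smul,
      hhw _ (inv_ne_one.2 hw), smul_zero, smul_zero]

/-- The value at `v` of the elements of `Hom_W(M, H)`. -/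
def evalHom {M : Type*} [AddCommGroup M] [Module ℂ M] (σ : Representation ℂ W M) (v : V) :
    homHarm b ρ σ →ₗ[ℂ] Module.Dual ℂ M where
  toFun φ := (evalAt b v).toLinearMap ∘ₗ φ.1
  map_add' _ _ := LinearMap.comp_add _ _ _
  map_smul' _ _ := LinearMap.comp_smul _ _ _

lemma evalHom_apply {M : Type*} [AddCommGroup M] [Module ℂ M] (σ : Representation ℂ W M) (v : V)
    (φ : homHarm b ρ σ) (m : M) : evalHom b ρ σ v φ m = evalAt b v (φ.1 m) := rfl

lemma bijective_evalHom [Finite W] {M : Type*} [AddCommGroup M] [Module ℂ M] [Module.Finite ℂ M]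
    (σ : Representation ℂ W M) {v : V} (hv : ∀ w, ρ w v = v → w = 1) {ι : Type*} [Fintype ι]
    (β : Module.Basis ι ℂ (homHarm b ρ σ)) (hM : Fintype.card ι = Module.finrank ℂ M) :
    Function.Bijective (evalHom b ρ σ v) := by
  have hsurj : Function.Surjective (evalHom b ρ σ v) := fun l => by
    obtain ⟨φ, hφ, hl⟩ := exists_homPoly_evalAt_eq b ρ σ hv l
    obtain ⟨g, hg, h⟩ := exists_eq_sum_mul b ρ σ β hφ
    refine ⟨∑ i, evalAt b v (g i) • β i, LinearMap.ext fun m => ?_⟩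
    rw [← hl, h, map_sum, map_sum, LinearMap.sum_apply]
    refine Finset.sum_congr rfl fun i _ => ?_
    rw [map_smul, LinearMap.smul_apply, evalHom_apply, map_mul, smul_eq_mul]
  refine ⟨?_, hsurj⟩
  have hdim : Module.finrank ℂ (ι → ℂ) = Module.finrank ℂ (Module.Dual ℂ M) := by
    rw [Module.finrank_fintype_fun_eq_card, hM, Subspace.dual_finrank_eq]
  have hinj := (LinearMap.injective_iff_surjective_of_finrank_eq_finrank hdim
    (f := evalHom b ρ σ v ∘ₗ β.equivFun.symm.toLinearMap)).2
    (hsurj.comp β.equivFun.symm.surjective)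
  have := hinj.comp β.equivFun.injective
  refine fun φ ψ h => this ?_
  simpa using h

end Regular

/-! ### The linear part of an element of a symmetric algebra -/

section LinearPart

variable {M : Type*} [AddCommGroup M] [Module ℂ M]

/-- The augmentation `Sym(M) → ℂ`. -/
def symAugmentation (M : Type*) [AddCommGroup M] [Module ℂ M] : SymmetricAlgebra ℂ M →ₐ[ℂ] ℂ :=
  SymmetricAlgebra.lift 0

lemma symLinearPart_algebraMap (c : ℂ) :
    symLinearPart M (algebraMap ℂ (SymmetricAlgebra ℂ M) c) = 0 := by
  simp only [symLinearPart, LinearMap.comp_apply, AlgHom.toLinearMap_apply, AlgHom.commutes]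
  rfl

lemma symLinearPart_mul (x y : SymmetricAlgebra ℂ M) : symLinearPart M (x * y) =
    symAugmentation M x • symLinearPart M y + symAugmentation M y • symLinearPart M x := by
  let _ : Module ℂᵐᵒᵖ M := Module.compHom M ((RingHom.id ℂ).fromOpposite mul_comm)
  have _ : IsCentralScalar ℂ M := ⟨fun _ _ => rfl⟩
  have h (z : SymmetricAlgebra ℂ M) :
      (SymmetricAlgebra.lift (TrivSqZeroExt.inrHom ℂ M) z).fst = symAugmentation M z := by
    have : (TrivSqZeroExt.fstHom ℂ ℂ M).comp (SymmetricAlgebra.lift (TrivSqZeroExt.inrHom ℂ M)) =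
        symAugmentation M :=
      SymmetricAlgebra.algHom_ext (LinearMap.ext fun m => by simp [symAugmentation])
    exact DFunLike.congr_fun this z
  have h2 (z : SymmetricAlgebra ℂ M) : symLinearPart M z =
    (SymmetricAlgebra.lift (TrivSqZeroExt.inrHom ℂ M) z).snd := rfl
  rw [h2, map_mul, TrivSqZeroExt.snd_mul, h, h, h2, h2]
  rfl

/-- A linear functional applied to the linear part, as a coefficient of the image under the
corresponding homomorphism to polynomials in one variable. -/
lemma coeff_one_lift (l : M →ₗ[ℂ] ℂ) (x : SymmetricAlgebra ℂ M) :
    (SymmetricAlgebra.lift (l.smulRight (Polynomial.X : Polynomial ℂ)) x).coeff 1 =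
      l (symLinearPart M x) := by
  set K := SymmetricAlgebra.lift (l.smulRight (Polynomial.X : Polynomial ℂ))
  have h0 (x : SymmetricAlgebra ℂ M) : (K x).coeff 0 = symAugmentation M x := by
    have : (Polynomial.aeval (0 : ℂ)).comp K = symAugmentation M :=
      SymmetricAlgebra.algHom_ext (LinearMap.ext fun m => by simp [symAugmentation, K])
    rw [← this, AlgHom.comp_apply, Polynomial.coeff_zero_eq_aeval_zero]
  induction x using SymmetricAlgebra.induction with
  | algebraMap c =>
    rw [AlgHom.commutes, symLinearPart_algebraMap, map_zero, Polynomial.algebraMap_apply,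
      Polynomial.coeff_C_of_ne_zero one_ne_zero]
  | ι m =>
    rw [symLinearPart_ι, SymmetricAlgebra.lift_ι_apply]
    simp
  | add x y hx hy => rw [map_add, Polynomial.coeff_add, hx, hy, map_add, map_add]
  | mul x y hx hy =>
    rw [map_mul, Polynomial.coeff_mul, Finset.Nat.antidiagonal_succ, symLinearPart_mul]
    simp [hx, hy, h0, mul_comm]

end LinearPart

/-! ### Perfect pairings with values in a line -/

section PerfectPairing

variable {P Q L : Type*} [AddCommMonoid P] [Module ℂ P] [AddCommMonoid Q] [Module ℂ Q]
  [AddCommMonoid L] [Module ℂ L]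

/-- A nondegenerate pairing of finite-dimensional spaces with values in a line is perfect. The
spaces are only assumed to be additive monoids, for the lemma to apply to submodules with their
inherited structure. -/
lemma isPerfectPairing_of_nondegenerate [Module.Finite ℂ P] [Module.Finite ℂ Q]
    {B : P →ₗ[ℂ] Q →ₗ[ℂ] L} (μ : L ≃ₗ[ℂ] ℂ)
    (hl : ∀ p, (∀ q, B p q = 0) → p = 0) (hr : ∀ q, (∀ p, B p q = 0) → q = 0) :
    IsPerfectPairing B := by
  let _ : AddCommGroup P := Module.addCommMonoidToAddCommGroup ℂ
  let _ : AddCommGroup Q := Module.addCommMonoidToAddCommGroup ℂ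
  let p : P →ₗ[ℂ] Q →ₗ[ℂ] ℂ := B.compr₂ μ.toLinearMap
  have hp (x : P) (y : Q) : p x y = μ (B x y) := rfl
  have hpp : p.IsPerfPair := LinearMap.IsPerfPair.of_injective
    ((injective_iff_map_eq_zero p).2 fun x hx => hl x fun y => μ.injective <| by
      rw [← hp, hx, map_zero]
      rfl)
    ((injective_iff_map_eq_zero p.flip).2 fun y hy => hr y fun x => μ.injective <| by
      rw [← hp, ← LinearMap.flip_apply, hy, map_zero]
      rfl)
  refine ⟨⟨fun x x' h => hpp.bijective_left.1 ?_, fun f => ?_⟩,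
    ⟨fun y y' h => hpp.bijective_right.1 ?_, fun f => ?_⟩⟩
  · ext y
    rw [hp, hp, h]
  · obtain ⟨x, hx⟩ := hpp.bijective_left.2 (μ.toLinearMap ∘ₗ f)
    exact ⟨x, LinearMap.ext fun y => μ.injective (LinearMap.congr_fun hx y)⟩
  · ext x
    change μ (B.flip y x) = μ (B.flip y' x)
    rw [h]
  · obtain ⟨y, hy⟩ := hpp.bijective_right.2 (μ.toLinearMap ∘ₗ f)
    exact ⟨y, LinearMap.ext fun x => μ.injective (LinearMap.congr_fun hy x)⟩

lemma finite_submodule {E : Type*} [AddCommMonoid E] [Module ℂ E] [Module.Finite ℂ E]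
    (E' : Submodule ℂ E) : Module.Finite ℂ E' := by
  let _ : AddCommGroup E := Module.addCommMonoidToAddCommGroup ℂ
  exact inferInstanceAs (Module.Finite ℂ E')

lemma isPerfectPairing_domRestrict₁₂ [Module.Finite ℂ P] [Module.Finite ℂ Q]
    {B : P →ₗ[ℂ] Q →ₗ[ℂ] L} (μ : L ≃ₗ[ℂ] ℂ) {P' : Submodule ℂ P} {Q' : Submodule ℂ Q}
    (hl : ∀ p ∈ P', (∀ q ∈ Q', B p q = 0) → p = 0)
    (hr : ∀ q ∈ Q', (∀ p ∈ P', B p q = 0) → q = 0) :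
    IsPerfectPairing (B.domRestrict₁₂ P' Q') := by
  have := finite_submodule P'
  have := finite_submodule Q'
  exact isPerfectPairing_of_nondegenerate μ
    (fun p h => Subtype.ext (hl p p.2 fun q hq => h ⟨q, hq⟩))
    (fun q h => Subtype.ext (hr q q.2 fun p hp => h ⟨p, hp⟩))

end PerfectPairing

/-! ### Duality groups and regular vectors -/

section Frame

variable {n : ℕ} {V W : Type*} [AddCommGroup V] [Module ℂ V] [Group W]
  (b : Module.Basis (Fin n) ℂ V) (ρ : Representation ℂ W V)

/-- Homogeneous bases of `Hom_W(V, H)` and `Hom_W(V*, H)` for a duality group of highest degree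
`d`, and a vector `v` with trivial stabilizer at which all basic invariants vanish except for the
one of degree `d`. -/
structure RegularFrame (d : ℕ) where
  /-- the degrees -/
  deg : Fin n → ℤ
  /-- the index of the highest degree -/
  top : Fin n
  /-- a homogeneous basis of `Hom_W(V, H)` -/
  basisV : Module.Basis (Fin n) ℂ (homHarm b ρ ρ)
  /-- a homogeneous basis of `Hom_W(V*, H)` -/
  basisDual : Module.Basis (Fin n) ℂ (homHarm b ρ ρ.dual)
  /-- the vector -/
  vec : V
  basisV_mem : ∀ i, basisV i ∈ homHarmDeg b ρ ρ (deg i - 1)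
  basisDual_mem : ∀ i, basisDual i ∈ homHarmDeg b ρ ρ.dual (d - deg i + 1)
  deg_top : deg top = d
  one_le_deg : ∀ i, 1 ≤ deg i
  deg_le : ∀ i, deg i ≤ d
  deg_lt : ∀ i ≠ top, deg i < d
  basisDual_top : ∃ s : ℂ, s ≠ 0 ∧ (basisDual top).1 = s • linearForm b
  eval_top : evalAt b vec (basicInvariant b ρ (basisV top)).1 = 1
  eval_of_ne : ∀ i ≠ top, evalAt b vec (basicInvariant b ρ (basisV i)).1 = 0
  eq_one : ∀ w, ρ w vec = vec → w = 1

lemma exists_regularFrame (hW : IsIrreducibleReflectionGroup ρ) {d : ℤ}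
    (hd : IsDualityGroup b ρ d) : ∃ D : ℕ, d = D ∧ Nonempty (RegularFrame b ρ D) := by
  have hWfin : Finite W := hW.finite
  have hfin : Module.Finite ℂ V := Module.Finite.of_basis b
  obtain ⟨a, c, ha, hc, ⟨⟨t, ht⟩, had⟩, hac⟩ := hd
  replace had (i : Fin n) : a i ≤ d := had ⟨i, rfl⟩
  obtain ⟨β, hβ⟩ := exists_homogeneous_basis b ρ ρ (u := fun i => a i - 1) fun j => by
    rw [show j = j + 1 - 1 by ring, ← ha.2 (j + 1)]
    simp only [sub_left_inj]
  obtain ⟨γ, hγ⟩ := exists_homogeneous_basis b ρ ρ.dual (u := fun i => c i + 1) fun j => by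
    rw [show j = j - 1 + 1 by ring, ← hc.2 (j - 1)]
    simp only [add_left_inj]
  have ha1 (i : Fin n) : 1 ≤ a i := by
    obtain ⟨m, hm⟩ := exists_natCast_degree β hβ i
    have hm' : a i - 1 = m := hm
    omega
  obtain ⟨D, rfl⟩ : ∃ D : ℕ, d = D := ⟨d.toNat, by have := ha1 t; omega⟩
  have hD : D ≠ 0 := by have := ha1 t; omega
  -- the members of `γ` of codegree zero are multiples of the identity of `V*`
  have hschur (i : Fin n) (hi : a i = D) : ∃ s : ℂ, (γ i).1 = s • linearForm b := by
    refine exists_eq_smul_linearForm b ρ hW.irreducible (γ i).2.1 fun ξ => ?_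
    have h1 := mem_polyDeg_of_mem_homHarmDeg b ρ ρ.dual (hγ i) ξ
    have h2 := hac i
    rwa [show c i + 1 = 1 by omega] at h1
  obtain ⟨s, hs⟩ := hschur t ht
  have hs0 : s ≠ 0 := by
    rintro rfl
    exact γ.ne_zero t (Subtype.ext (by rw [hs, zero_smul]; rfl))
  have hlt (i : Fin n) (hi : i ≠ t) : a i < D := by
    refine lt_of_le_of_ne (had i) fun h => ?_
    obtain ⟨s', hs'⟩ := hschur i h
    have h1 : s • γ i = s' • γ t := Subtype.ext <| by
      change s • (γ i).1 = s' • (γ t).1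
      rw [hs, hs', smul_comm]
    have h2 := congrArg (fun x => γ.repr x i) h1
    simp [hi.symm, hs0] at h2
  have hC := bijective_chevalleyMap b ρ β hβ
  obtain ⟨v, hv⟩ := exists_evalAt_basicInvariant_eq b ρ hC β (Pi.single t 1)
  have hv1 : evalAt b v (basicInvariant b ρ (β t)).1 = 1 := by rw [hv, Pi.single_eq_same]
  have hv2 (i : Fin n) (hi : i ≠ t) : evalAt b v (basicInvariant b ρ (β i)).1 = 0 := by
    rw [hv, Pi.single_eq_of_ne hi]
  have hpt : (basicInvariant b ρ (β t)).1 ∈ polyDeg n (D : ℤ) := by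
    have := basicInvariant_mem_polyDeg b ρ (hβ t)
    rwa [ht, sub_add_cancel] at this
  have hv0 : v ≠ 0 := by
    rintro rfl
    have h1 := evalAt_smul b hpt 0 (0 : V)
    rw [smul_zero, hv1, zero_pow hD, zero_mul] at h1
    exact one_ne_zero h1
  have hreg (w : W) (hw : ρ w v = v) : w = 1 := by
    refine eq_one_of_apply_eq b ρ hW.faithful γ hγ hv0 hD (fun g hg e he hge => ?_)
      (basicInvariant b ρ (β t)).2 hpt (by rw [hv1]; exact one_ne_zero) hs0 hs
      (fun i hi h => ?_) hw
    · refine evalAt_eq_zero_of_not_dvd b ρ hC.2 β hβ hD (fun i hi => hv2 i ?_) hg he hge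
      rintro rfl
      rw [ht, sub_add_cancel] at hi
      exact hi dvd_rfl
    · rw [add_sub_cancel_right] at h
      have h1 := hlt i hi
      have h2 := hac i
      have h3 := ha1 i
      have h4 := Int.le_of_dvd (by omega) h
      omega
  exact ⟨D, rfl, ⟨{
    deg := a
    top := t
    basisV := β
    basisDual := γ
    vec := v
    basisV_mem := hβ
    basisDual_mem := fun i => by
      have h1 := hγ i
      have h2 := hac i
      rwa [show c i = D - a i by omega] at h1
    deg_top := ht
    one_le_deg := ha1
    deg_le := had
    deg_lt := hlt
    basisDual_top := ⟨s, hs0, hs⟩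
    eval_top := hv1
    eval_of_ne := hv2
    eq_one := hreg }⟩⟩

namespace RegularFrame

variable {b ρ} {d : ℕ} (F : RegularFrame b ρ d)

/-- The value at the regular vector of the basic invariant attached to `φ`. -/
def topCoord : homHarm b ρ ρ →ₗ[ℂ] ℂ :=
  (evalAt b F.vec).toLinearMap ∘ₗ (invariants b ρ).val.toLinearMap ∘ₗ basicInvariant b ρ

lemma topCoord_apply (φ : homHarm b ρ ρ) :
    F.topCoord φ = evalAt b F.vec (basicInvariant b ρ φ).1 := rfl

lemma topCoord_basisV (i : Fin n) : F.topCoord (F.basisV i) = if i = F.top then 1 else 0 := by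
  rw [topCoord_apply]
  split_ifs with h
  · rw [h, F.eval_top]
  · exact F.eval_of_ne i h

lemma pos (F : RegularFrame b ρ d) : 0 < d := by
  have := F.one_le_deg F.top
  rw [F.deg_top] at this
  omega

/-- Homogeneous invariants of degree not divisible by `d` vanish at the regular vector. -/
lemma evalAt_eq_zero [Finite W] {g : MvPolynomial (Fin n) ℂ} (hg : g ∈ invariants b ρ) {e : ℤ}
    (he : ¬ (d : ℤ) ∣ e) (hge : g ∈ polyDeg n e) : evalAt b F.vec g = 0 := by
  refine evalAt_eq_zero_of_not_dvd b ρ (bijective_chevalleyMap b ρ F.basisV F.basisV_mem).2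
    F.basisV F.basisV_mem F.pos.ne' (fun i hi => F.eval_of_ne i ?_) hg he
    hge
  rintro rfl
  rw [F.deg_top, sub_add_cancel] at hi
  exact hi dvd_rfl

lemma exists_natCast_deg (i : Fin n) : ∃ m : ℕ, F.deg i = m :=
  ⟨(F.deg i).toNat, by have := F.one_le_deg i; omega⟩

lemma basicInvariant_mem (i : Fin n) :
    (basicInvariant b ρ (F.basisV i)).1 ∈ polyDeg n (F.deg i) := by
  have := basicInvariant_mem_polyDeg b ρ (F.basisV_mem i)
  rwa [sub_add_cancel] at this

end RegularFrame

/-- Restriction of a polynomial function to the line through `v`. -/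
def restrictLine (v : V) : MvPolynomial (Fin n) ℂ →ₐ[ℂ] Polynomial ℂ :=
  aeval fun i => Polynomial.C (b.coord i v) * Polynomial.X

lemma eval_restrictLine (v : V) (c : ℂ) (f : MvPolynomial (Fin n) ℂ) :
    (restrictLine b v f).eval c = evalAt b (c • v) f := by
  have : (Polynomial.aeval c).comp (restrictLine b v) = evalAt b (c • v) :=
    MvPolynomial.algHom_ext fun i => by
      simp only [restrictLine, evalAt, AlgHom.comp_apply, aeval_X, map_mul, Polynomial.aeval_C,
        Polynomial.aeval_X, map_smul, smul_eq_mul, Algebra.algebraMap_self, RingHom.id_apply]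
      exact mul_comm _ _
  rw [← this, AlgHom.comp_apply, Polynomial.coe_aeval_eq_eval]

lemma restrictLine_of_mem {m : ℕ} {f : MvPolynomial (Fin n) ℂ} (hf : f ∈ polyDeg n (m : ℤ))
    (v : V) : restrictLine b v f = Polynomial.monomial m (evalAt b v f) := by
  refine Polynomial.funext fun c => ?_
  rw [eval_restrictLine, evalAt_smul b hf, Polynomial.eval_monomial, mul_comm]

namespace RegularFrame

variable {b ρ} {d : ℕ} (F : RegularFrame b ρ d)

/-- The coefficient of the top basic invariant in the linear part of an invariant `g` is the
coefficient of `t ^ d` in `g (t v)`. -/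
lemma topCoord_symLinearPart [Finite W] (hC : Function.Bijective (chevalleyMap b ρ))
    (g : invariants b ρ) :
    F.topCoord (symLinearPart (homHarm b ρ ρ)
        ((AlgEquiv.ofBijective (chevalleyMap b ρ) hC).symm g)) =
      (restrictLine b F.vec g.1).coeff d := by
  obtain ⟨x, rfl⟩ := hC.2 g
  have hx : (AlgEquiv.ofBijective (chevalleyMap b ρ) hC).symm (chevalleyMap b ρ x) = x :=
    (AlgEquiv.ofBijective (chevalleyMap b ρ) hC).symm_apply_apply x
  have h1 := coeff_one_lift (M := homHarm b ρ ρ) F.topCoord x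
  have hline : ((restrictLine b F.vec).comp (invariants b ρ).val).comp (chevalleyMap b ρ) =
      (Polynomial.expand ℂ d).comp
        (SymmetricAlgebra.lift (F.topCoord.smulRight (Polynomial.X : Polynomial ℂ))) := by
    refine SymmetricAlgebra.algHom_ext (F.basisV.ext fun i => ?_)
    obtain ⟨m, hm⟩ := F.exists_natCast_deg i
    have hi := F.basicInvariant_mem i
    rw [hm] at hi
    have h2 := restrictLine_of_mem b hi F.vec
    have h3 : chevalleyMap b ρ (SymmetricAlgebra.ι ℂ _ (F.basisV i)) =
      basicInvariant b ρ (F.basisV i) := SymmetricAlgebra.lift_ι_apply _ _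
    change restrictLine b F.vec (chevalleyMap b ρ (SymmetricAlgebra.ι ℂ _ (F.basisV i))).1 =
      Polynomial.expand ℂ d (SymmetricAlgebra.lift _ (SymmetricAlgebra.ι ℂ _ (F.basisV i)))
    rw [h3, h2, SymmetricAlgebra.lift_ι_apply, LinearMap.smulRight_apply, map_smul,
      Polynomial.expand_X, ← F.topCoord_apply, F.topCoord_basisV]
    split_ifs with h
    · rw [h, F.deg_top, Nat.cast_inj] at hm
      rw [hm, one_smul, Polynomial.monomial_one_right_eq_X_pow]
    · rw [map_zero, zero_smul]
  have h2 : restrictLine b F.vec (chevalleyMap b ρ x).1 = Polynomial.expand ℂ d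
      (SymmetricAlgebra.lift (F.topCoord.smulRight (Polynomial.X : Polynomial ℂ)) x) :=
    DFunLike.congr_fun hline x
  have h3 := Polynomial.coeff_expand_mul F.pos
    (SymmetricAlgebra.lift (F.topCoord.smulRight (Polynomial.X : Polynomial ℂ)) x) 1
  rw [one_mul] at h3
  rw [hx, h2, h3]
  exact h1.symm

lemma topCoord_symLinearPart_of_mem [Finite W] (hC : Function.Bijective (chevalleyMap b ρ))
    {g : invariants b ρ} {e : ℤ} (hg : g.1 ∈ polyDeg n e) :
    F.topCoord (symLinearPart (homHarm b ρ ρ)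
        ((AlgEquiv.ofBijective (chevalleyMap b ρ) hC).symm g)) =
      if e = d then evalAt b F.vec g.1 else 0 := by
  rw [topCoord_symLinearPart]
  by_cases hg0 : g.1 = 0
  · rw [hg0, map_zero, map_zero, Polynomial.coeff_zero, ite_self]
  obtain ⟨m, rfl⟩ := exists_natCast_eq_of_mem_polyDeg hg hg0
  rw [restrictLine_of_mem b hg, Polynomial.coeff_monomial]
  simp only [Nat.cast_inj]

/-- The pairing of `φ` and `ψ` is the pairing of their values at the regular vector. -/
lemma evalAt_contract (φ : homHarm b ρ ρ) (ψ : homHarm b ρ ρ.dual) :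
    evalAt b F.vec (contract b φ.1 ψ.1) =
      evalHom b ρ ρ.dual F.vec ψ (evalHom b ρ ρ F.vec φ) := by
  have h : evalHom b ρ ρ F.vec φ = ∑ i, evalHom b ρ ρ F.vec φ (b i) • b.coord i :=
    b.ext fun j => by simp
  conv_rhs => rw [h, map_sum]
  rw [contract, map_sum]
  refine Finset.sum_congr rfl fun i _ => ?_
  rw [map_mul, map_smul, smul_eq_mul]
  rfl

/-- The linear functional `topCoord` on the linear part of `contract φ ψ` is the value of
`contract φ ψ` at the regular vector. -/
lemma topCoord_invariantPairing [Finite W] (hC : Function.Bijective (chevalleyMap b ρ))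
    (φ : homHarm b ρ ρ) (ψ : homHarm b ρ ρ.dual) :
    F.topCoord (symLinearPart (homHarm b ρ ρ) ((AlgEquiv.ofBijective (chevalleyMap b ρ) hC).symm
      (invariantPairing b ρ φ ψ))) = evalAt b F.vec (contract b φ.1 ψ.1) := by
  let A : homHarm b ρ ρ →ₗ[ℂ] homHarm b ρ ρ.dual →ₗ[ℂ] ℂ :=
    (invariantPairing b ρ).compr₂ (F.topCoord ∘ₗ symLinearPart (homHarm b ρ ρ) ∘ₗ
      (AlgEquiv.ofBijective (chevalleyMap b ρ) hC).symm.toLinearMap)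
  let A' : homHarm b ρ ρ →ₗ[ℂ] homHarm b ρ ρ.dual →ₗ[ℂ] ℂ :=
    (invariantPairing b ρ).compr₂ ((evalAt b F.vec).toLinearMap ∘ₗ
      (invariants b ρ).val.toLinearMap)
  suffices A = A' from LinearMap.congr_fun (LinearMap.congr_fun this φ) ψ
  refine F.basisV.ext fun i => F.basisDual.ext fun j => ?_
  change F.topCoord (symLinearPart (homHarm b ρ ρ)
      ((AlgEquiv.ofBijective (chevalleyMap b ρ) hC).symm
        (invariantPairing b ρ (F.basisV i) (F.basisDual j)))) =
    evalAt b F.vec (invariantPairing b ρ (F.basisV i) (F.basisDual j)).1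
  have hmem : (invariantPairing b ρ (F.basisV i) (F.basisDual j)).1 ∈
      polyDeg n (F.deg i - 1 + (d - F.deg j + 1)) :=
    contract_mem_polyDeg b (mem_polyDeg_of_mem_homHarmDeg b ρ ρ (F.basisV_mem i))
      (mem_polyDeg_of_mem_homHarmDeg b ρ ρ.dual (F.basisDual_mem j))
  rw [F.topCoord_symLinearPart_of_mem hC hmem]
  split_ifs with h
  · rfl
  · refine (F.evalAt_eq_zero (invariantPairing b ρ (F.basisV i) (F.basisDual j)).2
      (fun hdvd => h ?_) hmem).symm
    -- the degree `deg i + d - deg j` lies strictly between `0` and `2 * d`, so it is not a multiple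
    -- of `d` unless it is `d`
    obtain ⟨k, hk⟩ := hdvd
    have h1 := F.one_le_deg i
    have h2 := F.one_le_deg j
    have h3 := F.deg_le i
    have h4 := F.deg_le j
    have h5 := Int.natCast_pos.2 F.pos
    have hk1 : k = 1 := by
      have : 0 < k := by nlinarith
      have : k < 2 := by nlinarith
      omega
    rw [hk, hk1, mul_one]

/-- Contractions of degree other than `d` vanish at the regular vector. -/
lemma evalAt_contract_eq_zero [Finite W] {j k : ℤ} (hjk : j + k ≠ d) {φ : homHarm b ρ ρ}
    (hφ : φ ∈ homHarmDeg b ρ ρ j) {ψ : homHarm b ρ ρ.dual} (hψ : ψ ∈ homHarmDeg b ρ ρ.dual k) :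
    evalAt b F.vec (contract b φ.1 ψ.1) = 0 := by
  have hC := bijective_chevalleyMap b ρ F.basisV F.basisV_mem
  have hmem : (invariantPairing b ρ φ ψ).1 ∈ polyDeg n (j + k) :=
    contract_mem_polyDeg b (mem_polyDeg_of_mem_homHarmDeg b ρ ρ hφ)
      (mem_polyDeg_of_mem_homHarmDeg b ρ ρ.dual hψ)
  rw [← F.topCoord_invariantPairing hC, F.topCoord_symLinearPart_of_mem hC hmem, if_neg hjk]

/-- Nondegeneracy on the left of `φ, ψ ↦ contract φ ψ (v)`: it is the pairing of `V*` and `V**`. -/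
lemma eq_zero_of_evalAt_contract_left [Finite W] {φ : homHarm b ρ ρ}
    (h : ∀ j, evalAt b F.vec (contract b φ.1 (F.basisDual j).1) = 0) : φ = 0 := by
  have hfin : Module.Finite ℂ V := Module.Finite.of_basis b
  have hn : Fintype.card (Fin n) = Module.finrank ℂ V := (Module.finrank_eq_card_basis b).symm
  have h1 := bijective_evalHom b ρ ρ F.eq_one F.basisV hn
  have h2 := bijective_evalHom b ρ ρ.dual F.eq_one F.basisDual
    (hn.trans Subspace.dual_finrank_eq.symm)
  let E := Module.Dual.eval ℂ (Module.Dual ℂ V) (evalHom b ρ ρ F.vec φ)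
  have h3 : E ∘ₗ evalHom b ρ ρ.dual F.vec = 0 := F.basisDual.ext fun j => by
    rw [LinearMap.comp_apply, Module.Dual.eval_apply, ← F.evalAt_contract, h]
    rfl
  have h4 (l : Module.Dual ℂ (Module.Dual ℂ V)) : l (evalHom b ρ ρ F.vec φ) = 0 := by
    obtain ⟨ψ, rfl⟩ := h2.2 l
    exact LinearMap.congr_fun h3 ψ
  refine h1.1 ?_
  rw [map_zero]
  exact (Module.forall_dual_apply_eq_zero_iff ℂ _).1 h4

/-- Nondegeneracy on the right of `φ, ψ ↦ contract φ ψ (v)`. -/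
lemma eq_zero_of_evalAt_contract_right [Finite W] {ψ : homHarm b ρ ρ.dual}
    (h : ∀ i, evalAt b F.vec (contract b (F.basisV i).1 ψ.1) = 0) : ψ = 0 := by
  have hfin : Module.Finite ℂ V := Module.Finite.of_basis b
  have hn : Fintype.card (Fin n) = Module.finrank ℂ V := (Module.finrank_eq_card_basis b).symm
  have h1 := bijective_evalHom b ρ ρ F.eq_one F.basisV hn
  have h2 := bijective_evalHom b ρ ρ.dual F.eq_one F.basisDual
    (hn.trans Subspace.dual_finrank_eq.symm)
  have h3 : evalHom b ρ ρ.dual F.vec ψ ∘ₗ evalHom b ρ ρ F.vec = 0 := F.basisV.ext fun i => by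
    rw [LinearMap.comp_apply, ← F.evalAt_contract, h]
    rfl
  refine h2.1 (LinearMap.ext fun l => ?_)
  obtain ⟨φ, rfl⟩ := h1.2 l
  rw [map_zero]
  exact LinearMap.congr_fun h3 φ

end RegularFrame

end Frame

/-! ### The duality pairing -/

section Duality

variable {n : ℕ} {V W : Type*} [AddCommGroup V] [Module ℂ V] [Group W]
  {b : Module.Basis (Fin n) ℂ V} {ρ : Representation ℂ W V}

lemma injective_of_eq_zero {E : Type*} [AddCommMonoid E] [Module ℂ E] {l : E →ₗ[ℂ] ℂ}
    (hl : ∀ x, l x = 0 → x = 0) : Function.Injective l := by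
  let _ : AddCommGroup E := Module.addCommMonoidToAddCommGroup ℂ
  exact (injective_iff_map_eq_zero l).2 hl

lemma finite_homCoinv {M : Type*} [AddCommGroup M] [Module ℂ M] {σ : Representation ℂ W M}
    (hA : Function.Bijective (harmonicsToCoinvariants b ρ))
    (β : Module.Basis (Fin n) ℂ (homHarm b ρ σ)) : Module.Finite ℂ (homCoinv b ρ σ) :=
  Module.Finite.of_basis
    (β.map (LinearEquiv.ofBijective (liftHarm b ρ σ hA) (bijective_liftHarm b ρ σ hA)).symm)

namespace RegularFrame

variable {d : ℕ} (F : RegularFrame b ρ d)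

/-- An element of `Hom_W(V, H)_d` is determined by its top coordinate, for its contractions with all
basis vectors of `Hom_W(V*, H)` but the multiple of the identity of `V*` vanish at the regular
vector. -/
lemma eq_zero_of_topCoord_eq_zero [Finite W] (F : RegularFrame b ρ d) {φ : homHarm b ρ ρ}
    (hφ : φ ∈ homHarmDeg b ρ ρ (d - 1)) (h : F.topCoord φ = 0) : φ = 0 := by
  refine F.eq_zero_of_evalAt_contract_left fun j => ?_
  by_cases hj : j = F.top
  · obtain ⟨s, -, hs⟩ := F.basisDual_top
    have h1 : contract b φ.1 (s • linearForm b) = s • (basicInvariant b ρ φ).1 := by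
      simp only [contract, LinearMap.smul_apply, mul_smul_comm, ← Finset.smul_sum]
      rfl
    rw [hj, hs, h1, map_smul, ← F.topCoord_apply, h, smul_zero]
  · have := F.deg_lt j hj
    exact F.evalAt_contract_eq_zero (by omega) hφ (F.basisDual_mem j)

/-- Passing to the component of degree `d` and to coinvariants does not change the top coordinate,
which vanishes on the basis vectors of smaller degree. -/
lemma topCoord_liftHarm_componentToCoinv [Finite W]
    (hA : Function.Bijective (harmonicsToCoinvariants b ρ)) (φ : homHarm b ρ ρ) :
    F.topCoord (liftHarm b ρ ρ hA (componentToCoinv b ρ d φ).1) = F.topCoord φ := by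
  let T := F.topCoord ∘ₗ liftHarm b ρ ρ hA ∘ₗ (homCoinvDeg b ρ d).subtype ∘ₗ
    componentToCoinv b ρ d
  suffices T = F.topCoord from LinearMap.congr_fun this φ
  refine F.basisV.ext fun i => ?_
  change F.topCoord (liftHarm b ρ ρ hA (componentToCoinv b ρ d (F.basisV i)).1) = _
  have hi := mem_polyDeg_of_mem_homHarmDeg b ρ ρ (F.basisV_mem i)
  have h1 (m : V) : toCoinvariants b ρ
      ((liftHarm b ρ ρ hA (componentToCoinv b ρ d (F.basisV i)).1).1 m) =
      toCoinvariants b ρ (polyComponent n (d - 1) ((F.basisV i).1 m)) :=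
    toCoinvariants_liftHarm b ρ ρ hA _ m
  by_cases h : i = F.top
  · congr 1
    refine Subtype.ext (LinearMap.ext fun m => ?_)
    refine eq_of_toCoinvariants_eq b ρ hA
      ((liftHarm b ρ ρ hA (componentToCoinv b ρ d (F.basisV i)).1).2.2 m)
      ((F.basisV i).2.2 m) ((h1 m).trans ?_)
    have h2 := hi m
    rw [h, F.deg_top] at h2
    rw [h, polyComponent_of_mem h2]
  · have h0 : liftHarm b ρ ρ hA (componentToCoinv b ρ d (F.basisV i)).1 = 0 := by
      refine Subtype.ext (LinearMap.ext fun m => ?_)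
      refine eq_of_toCoinvariants_eq b ρ hA
        ((liftHarm b ρ ρ hA (componentToCoinv b ρ d (F.basisV i)).1).2.2 m)
        (zero_mem (harmonics b ρ)) ((h1 m).trans ?_)
      have h2 := F.deg_lt i h
      rw [polyComponent_of_mem_ne (by omega) (hi m)]
      rfl
    rw [h0, map_zero, F.topCoord_basisV, if_neg h]

lemma bijective_topCoord_liftHarm [Finite W]
    (hA : Function.Bijective (harmonicsToCoinvariants b ρ)) :
    Function.Bijective
      (F.topCoord ∘ₗ liftHarm b ρ ρ hA ∘ₗ (homCoinvDeg b ρ d).subtype) := by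
  refine ⟨injective_of_eq_zero fun χ hχ => ?_, fun z => ?_⟩
  · have h := F.eq_zero_of_topCoord_eq_zero
      (φ := liftHarm b ρ ρ hA χ.1) ((liftHarm_mem_iff b ρ ρ hA _ χ.1).2 χ.2) hχ
    exact Subtype.ext ((bijective_liftHarm b ρ ρ hA).1 (h.trans (map_zero _).symm))
  · refine ⟨componentToCoinv b ρ d (z • F.basisV F.top), ?_⟩
    refine (F.topCoord_liftHarm_componentToCoinv hA _).trans ?_
    rw [map_smul, F.topCoord_basisV, if_pos rfl, smul_eq_mul, mul_one]

/-- The identification of the line `Hom_W(V, A)_d` with `ℂ` by the top coordinate. -/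
def topEquiv [Finite W] (hA : Function.Bijective (harmonicsToCoinvariants b ρ)) :
    homCoinvDeg b ρ d ≃ₗ[ℂ] ℂ :=
  LinearEquiv.ofBijective _ (F.bijective_topCoord_liftHarm hA)

lemma topEquiv_dualityPairing [Finite W] (hA : Function.Bijective (harmonicsToCoinvariants b ρ))
    (hC : Function.Bijective (chevalleyMap b ρ)) (φ : homCoinv b ρ ρ) (ψ : homCoinv b ρ ρ.dual) :
    F.topEquiv hA (dualityPairing b ρ hA hC d φ ψ) = evalAt b F.vec
      (contract b (liftHarm b ρ ρ hA φ).1 (liftHarm b ρ ρ.dual hA ψ).1) :=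
  (F.topCoord_liftHarm_componentToCoinv hA _).trans (F.topCoord_invariantPairing hC _ _)

lemma dualityPairing_eq_zero_iff [Finite W] (F : RegularFrame b ρ d)
    (hA : Function.Bijective (harmonicsToCoinvariants b ρ))
    (hC : Function.Bijective (chevalleyMap b ρ)) (φ : homCoinv b ρ ρ) (ψ : homCoinv b ρ ρ.dual) :
    dualityPairing b ρ hA hC d φ ψ = 0 ↔ evalAt b F.vec
      (contract b (liftHarm b ρ ρ hA φ).1 (liftHarm b ρ ρ.dual hA ψ).1) = 0 := by
  rw [← F.topEquiv_dualityPairing hA hC, LinearEquiv.map_eq_zero_iff]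

lemma dualityPairing_eq_zero [Finite W] (F : RegularFrame b ρ d)
    (hA : Function.Bijective (harmonicsToCoinvariants b ρ))
    (hC : Function.Bijective (chevalleyMap b ρ)) {i j : ℤ} (hij : i + j ≠ d)
    {φ : homCoinv b ρ ρ} (hφ : φ ∈ homCoinvDeg b ρ i)
    {ψ : homCoinv b ρ ρ.dual} (hψ : ψ ∈ homCoinvDualDeg b ρ j) :
    dualityPairing b ρ hA hC d φ ψ = 0 :=
  (F.dualityPairing_eq_zero_iff hA hC φ ψ).2 <|
    F.evalAt_contract_eq_zero (j := i - 1) (k := j + 1) (by omega)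
      ((liftHarm_mem_iff b ρ ρ hA _ φ).2 hφ) ((liftHarm_mem_iff b ρ ρ.dual hA _ ψ).2 hψ)

/-- Nondegeneracy on the left, which can be tested on homogeneous elements. -/
lemma eq_zero_of_dualityPairing_left [Finite W] (F : RegularFrame b ρ d)
    (hA : Function.Bijective (harmonicsToCoinvariants b ρ))
    (hC : Function.Bijective (chevalleyMap b ρ))
    {φ : homCoinv b ρ ρ} (h : ∀ j, ∀ ψ ∈ homCoinvDualDeg b ρ j,
      dualityPairing b ρ hA hC d φ ψ = 0) : φ = 0 := by
  refine (bijective_liftHarm b ρ ρ hA).1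
    (Eq.trans (F.eq_zero_of_evalAt_contract_left fun j => ?_) (map_zero _).symm)
  obtain ⟨ψ, hψ⟩ := (bijective_liftHarm b ρ ρ.dual hA).2 (F.basisDual j)
  rw [← hψ, ← F.dualityPairing_eq_zero_iff hA hC]
  refine h (d - F.deg j) ψ ((liftHarm_mem_iff b ρ ρ.dual hA _ ψ).1 ?_)
  rw [hψ]
  exact F.basisDual_mem j

/-- Nondegeneracy on the right, which can be tested on homogeneous elements. -/
lemma eq_zero_of_dualityPairing_right [Finite W] (F : RegularFrame b ρ d)
    (hA : Function.Bijective (harmonicsToCoinvariants b ρ))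
    (hC : Function.Bijective (chevalleyMap b ρ)) {ψ : homCoinv b ρ ρ.dual}
    (h : ∀ i, ∀ φ ∈ homCoinvDeg b ρ i, dualityPairing b ρ hA hC d φ ψ = 0) : ψ = 0 := by
  refine (bijective_liftHarm b ρ ρ.dual hA).1
    (Eq.trans (F.eq_zero_of_evalAt_contract_right fun i => ?_) (map_zero _).symm)
  obtain ⟨φ, hφ⟩ := (bijective_liftHarm b ρ ρ hA).2 (F.basisV i)
  rw [← hφ, ← F.dualityPairing_eq_zero_iff hA hC]
  refine h (F.deg i) φ ((liftHarm_mem_iff b ρ ρ hA _ φ).1 ?_)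
  rw [hφ]
  exact F.basisV_mem i

end RegularFrame

end Duality

end ReflectionGroup

end

theorem theorem1 {n : ℕ} {V W : Type*} [AddCommGroup V] [Module ℂ V] [Group W]
    (b : Module.Basis (Fin n) ℂ V) (ρ : Representation ℂ W V)
    (hW : ReflectionGroup.IsIrreducibleReflectionGroup ρ)
    (d : ℤ) (hd : ReflectionGroup.IsDualityGroup b ρ d) :
    Module.finrank ℂ (ReflectionGroup.homCoinvDeg b ρ d) = 1 ∧
    ∃ (hA : Function.Bijective (ReflectionGroup.harmonicsToCoinvariants b ρ))
      (hC : Function.Bijective (ReflectionGroup.chevalleyMap b ρ)),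
      ReflectionGroup.IsPerfectPairing (ReflectionGroup.dualityPairing b ρ hA hC d) ∧
      (∀ i j : ℤ, i + j ≠ d → ∀ φ ∈ ReflectionGroup.homCoinvDeg b ρ i,
        ∀ ψ ∈ ReflectionGroup.homCoinvDualDeg b ρ j,
          ReflectionGroup.dualityPairing b ρ hA hC d φ ψ = 0) ∧
      (∀ k : ℤ, ReflectionGroup.IsPerfectPairing
        ((ReflectionGroup.dualityPairing b ρ hA hC d).domRestrict₁₂
          (ReflectionGroup.homCoinvDeg b ρ k)
          (ReflectionGroup.homCoinvDualDeg b ρ (d - k)))) := by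
  have hWfin : Finite W := hW.finite
  obtain ⟨D, rfl, ⟨F⟩⟩ := ReflectionGroup.exists_regularFrame b ρ hW hd
  have hA := ReflectionGroup.bijective_harmonicsToCoinvariants b ρ
  have hC := ReflectionGroup.bijective_chevalleyMap b ρ F.basisV F.basisV_mem
  have hfin := ReflectionGroup.finite_homCoinv hA F.basisV
  have hfin' := ReflectionGroup.finite_homCoinv hA F.basisDual
  refine ⟨(F.topEquiv hA).finrank_eq.trans (Module.finrank_self ℂ), hA, hC,
    ReflectionGroup.isPerfectPairing_of_nondegenerate (F.topEquiv hA)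
      (fun φ h => F.eq_zero_of_dualityPairing_left hA hC fun _ ψ _ => h ψ)
      (fun ψ h => F.eq_zero_of_dualityPairing_right hA hC fun _ φ _ => h φ),
    fun i j hij φ hφ ψ hψ => F.dualityPairing_eq_zero hA hC hij hφ hψ,
    fun k => ReflectionGroup.isPerfectPairing_domRestrict₁₂ (F.topEquiv hA) (fun φ hφ h => ?_)
      (fun ψ hψ h => ?_)⟩
  · refine F.eq_zero_of_dualityPairing_left hA hC fun j ψ hψ => ?_
    by_cases hj : j = D - k
    · exact h ψ (hj ▸ hψ)
    · exact F.dualityPairing_eq_zero hA hC (by omega) hφ hψ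
  · refine F.eq_zero_of_dualityPairing_right hA hC fun i φ hφ => ?_
    by_cases hi : i = k
    · exact h φ (hi ▸ hφ)
    · exact F.dualityPairing_eq_zero hA hC (by omega) hφ hψ
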